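/- Fix a universal prefix-free machine $U$; $K(x\mid y)$ denotes the length of a shortest program with which $U$ outputs the binary string $x$ when given the binary string $y$, $K(x)=K(x\mid\varepsilon)$ where $\varepsilon$ is the empty string, tuples of strings are encoded as single strings by a standard self-delimiting code, and for every string $z$ a shortest program $z^*$ that outputs $z$ is fixed. Logarithms are to base $2$ and $-\log 0=+\infty$. Consider causal Bayesian networks on $n$ nodes: a directed acyclic graph $G$ on $\{1,\dots,n\}$, discrete variables $X_j$ with values in sets $\mathcal X_j\subseteq\{0,1\}^*$, and for each $j$ a mechanism, i.e. a computable conditional distribution $P_{X_j\mid PA_j}$ on $\mathcal X_j$ given the values of the parents of $j$ in $G$. Each mechanism is given by a binary string (a program computing it), also denoted $P_{X_j\mid PA_j}$; the joint distribution is $P(x_1,\dots,x_n)=\prod_j P(x_j\mid pa_j)$, where $pa_j$ is the tuple of the values $x_i$ at the parents $i$ of $j$, and, as an object with a description, $P$ is given by the tuple of its $n$ mechanisms. For $x_j\in\mathcal X_j$ put $$\delta(x_1,\dots,x_n)=-\log P(x_1,\dots,x_n)-K(x_1,\dots,x_n\mid P^*),\qquad \delta(x_j\mid pa_j)=-\log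 P(x_j\mid pa_j)-K\big(x_j\mid (pa_j,P_{X_j\mid PA_j})^*\big).$$ A directed acyclic graph $H$ with strings $w_v$ at its nodes satisfies the algorithmic Markov condition with error $C$ if $$\Big|K\big((w_v)_v\big)-\sum_{v}K(w_v\mid pa_v^*)\Big|\le C,$$ where $pa_v$ is the tuple of the strings at the parents of $v$ in $H$. The augmented graph $G^1$ has the $2n$ nodes $x_1,\dots,x_n,P_{X_1\mid PA_1},\dots,P_{X_n\mid PA_n}$, the edges of $G$ between the $x_j$, and an edge from $P_{X_j\mid PA_j}$ to $x_j$ for each $j$. Theorem (Decomposition of joint randomness deficiency). For every $n$ and every $C$ there is a constant $C'$ (depending only on $n$, $C$, the machine $U$ and the choice of shortest programs) such that, for all networks on $n$ nodes as above and all $x_1\in\mathcal X_1,\dots,x_n\in\mathcal X_n$: if the algorithmic Markov condition holds with error $C$ for $G^1$ with the strings $x_1,\dots,x_n$, $P_{X_1\mid PA_1},\dots,P_{X_n\mid PA_n}$, then $\delta(x_1,\dots,x_n)$ and $\sum_{j=1}^n\delta(x_j\mid pa_j)$ differ by at most $C'$ (both being $+\infty$ if $P(x_1,\dots,x_n)=0$).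 -/

import Mathlib

namespace AlgCausal

/-- Binary strings. -/
abbrev Word : Type := List Bool

/-- A machine takes a program and a side-information string, and outputs a string if it halts. -/
abbrev Machine : Type := Word → Word →. Word

/-- A prefix-free machine: a partial recursive function such that, for every side information `y`,
the set of halting programs is prefix-free. -/
structure IsPrefixMachine (V : Machine) : Prop where
  partrec : Partrec₂ V
  prefixFree : ∀ y p q : Word, (V p y).Dom → (V q y).Dom → p <+: q → p = q

/-- A universal prefix-free machine: it simulates every prefix-free machine, lengthening the
programs by at most a constant that depends only on the simulated machine. -/
structure IsUniversalPrefixMachine (U : Machine) : Prop where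
  isPrefixMachine : IsPrefixMachine U
  universal : ∀ V : Machine, IsPrefixMachine V →
    ∃ c : ℕ, ∀ p y x : Word, x ∈ V p y → ∃ q : Word, x ∈ U q y ∧ q.length ≤ p.length + c

/-- Conditional Kolmogorov complexity `K(x ∣ y)`: the length of a shortest program that outputs
`x` when given `y`. (For universal `U` such a program always exists.) -/
noncomputable def K (U : Machine) (x y : Word) : ℕ :=
  sInf {l : ℕ | ∃ p : Word, x ∈ U p y ∧ p.length = l}

/-- `star` picks, for every string `z`, a shortest program `z^*` that outputs `z`
(with empty side information). -/
def IsShortestProgramMap (U : Machine) (star : Word → Word) : Prop :=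
  ∀ z : Word, z ∈ U (star z) [] ∧ ∀ q : Word, z ∈ U q [] → (star z).length ≤ q.length

/-- The self-delimiting code `1^{|x|} 0 x` of a string `x`. -/
def selfDelim (x : Word) : Word := List.replicate x.length true ++ false :: x

/-- The standard encoding of a tuple of strings as one string: the concatenation of the
self-delimiting codes of its entries. -/
def tuple (l : List Word) : Word := l.flatMap selfDelim

/-- A directed graph is acyclic if no vertex can be reached from itself along a nonempty directed
path. -/
def Acyclic {V : Type} (G : Digraph V) : Prop := ∀ v : V, ¬ Relation.TransGen G.Adj v v

open Classical in
/-- The list of the parents of `v`, in increasing order. -/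
noncomputable def parents {V : Type} [Fintype V] [LinearOrder V] (G : Digraph V) (v : V) :
    List V :=
  (Finset.univ.filter fun u => G.Adj u v).sort (· ≤ ·)

/-- The algorithmic Markov condition for strings `w v` attached to the nodes `v` of a directed
graph `G`, with additive error at most `C`:
`K((w_v)_v) = ∑_v K(w_v ∣ pa_v^*) ± C`, where `pa_v` is the tuple of the strings at the parents
of `v`. -/
def AlgMarkov {V : Type} [Fintype V] [LinearOrder V] (U : Machine) (star : Word → Word)
    (G : Digraph V) (w : V → Word) (C : ℝ) : Prop :=
  |(K U (tuple (((Finset.univ : Finset V).sort (· ≤ ·)).map w)) [] : ℝ)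
    - ∑ v : V, (K U (w v) (star (tuple ((parents G v).map w))) : ℝ)| ≤ C

/-- The program, in Mathlib's universal programming language for the partial recursive functions,
that a word denotes: the word is read as the binary expansion (least significant bit first) of the
Gödel number of the program, so every program is denoted by some word. -/
def codeOf (m : Word) : Nat.Partrec.Code :=
  Denumerable.ofNat Nat.Partrec.Code (Nat.ofDigits 2 (m.map Bool.toNat))

/-- The word `m`, read as a program, computes the real numbers `P a x` for all `a ∈ A` and `x ∈ X`: on input `(a, x, k)` it halts with a natural number
`N` such that `N / 2 ^ k` approximates `P a x` up to `2 ^ (-k)`. -/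
def Describes (m : Word) (A : Set (List Word)) (X : Set Word) (P : List Word → Word → ℝ) : Prop :=
  ∀ a ∈ A, ∀ x ∈ X, ∀ k : ℕ,
    ∃ N ∈ (codeOf m).eval (Encodable.encode (a, x, k)),
      |(N : ℝ) / 2 ^ k - P a x| ≤ (1 / 2) ^ k

/-- A causal Bayesian network on the nodes `0, …, n - 1` with discrete variables: the `j`-th
variable takes values in a set `dom j` of binary strings, and the `j`-th mechanism is a computable
conditional distribution `x ↦ P_j(x ∣ a)` on `dom j`, given the tuple `a` of values of the parents
(in increasing order of the nodes), together with a binary string `mech j` describing it. -/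
structure CausalNetwork (n : ℕ) where
  G : Digraph (Fin n)
  acyclic : Acyclic G
  dom : Fin n → Set Word
  prob : Fin n → List Word → Word → ℝ
  prob_nonneg : ∀ (j : Fin n) (x : Fin n → Word), (∀ i, x i ∈ dom i) →
    ∀ y ∈ dom j, 0 ≤ prob j ((parents G j).map x) y
  prob_hasSum : ∀ (j : Fin n) (x : Fin n → Word), (∀ i, x i ∈ dom i) →
    HasSum (fun y : dom j => prob j ((parents G j).map x) (y : Word)) 1
  mech : Fin n → Word
  mech_describes : ∀ j : Fin n, Describes (mech j)
    {a : List Word | ∃ x : Fin n → Word, (∀ i, x i ∈ dom i) ∧ a = (parents G j).map x}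
    (dom j) (prob j)

/-- `-log₂ p` for `p ≥ 0`, with value `+∞` at `p = 0`. -/
noncomputable def negLog (p : ℝ) : EReal :=
  if p = 0 then ⊤ else ((-Real.logb 2 p : ℝ) : EReal)

namespace CausalNetwork

variable {n : ℕ}

/-- The tuple of the values of the parents of node `j`. -/
noncomputable def pa (N : CausalNetwork n) (x : Fin n → Word) (j : Fin n) : List Word :=
  (parents N.G j).map x

/-- The joint probability `P(x_1, …, x_n) = ∏_j P(x_j ∣ pa_j)`. -/
noncomputable def jointProb (N : CausalNetwork n) (x : Fin n → Word) : ℝ :=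
  ∏ j : Fin n, N.prob j (N.pa x j) (x j)

/-- The augmented graph `G^1`: a node `inl j` for the observation `x_j`, a node `inr j` for the
mechanism `P_{X_j ∣ PA_j}`, the edges of `G` between observations, and an edge from each mechanism
to its observation. The nodes are ordered as `x_1, …, x_n, P_1, …, P_n`. -/
def augmented (N : CausalNetwork n) : Digraph (Fin n ⊕ₗ Fin n) where
  Adj u v := match ofLex u, ofLex v with
    | Sum.inl i, Sum.inl j => N.G.Adj i j
    | Sum.inr i, Sum.inl j => i = j
    | _, Sum.inr _ => False

/-- The strings at the nodes of `G^1`. -/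
def augmentedWord (N : CausalNetwork n) (x : Fin n → Word) (v : Fin n ⊕ₗ Fin n) : Word :=
  Sum.elim x N.mech (ofLex v)

/-- The joint randomness deficiency
`δ(x_1, …, x_n) = -log P(x_1, …, x_n) - K(x_1, …, x_n ∣ P^*)`, where the joint distribution `P` of
the network is given by the tuple of the descriptions of its mechanisms. -/
noncomputable def jointDeficiency (N : CausalNetwork n) (U : Machine) (star : Word → Word)
    (x : Fin n → Word) : EReal :=
  negLog (N.jointProb x) -
    ((K U (tuple (List.ofFn x)) (star (tuple (List.ofFn N.mech))) : ℝ) : EReal)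

/-- The conditional randomness deficiency
`δ(x_j ∣ pa_j) = -log P(x_j ∣ pa_j) - K(x_j ∣ (pa_j, P_{X_j ∣ PA_j})^*)`. -/
noncomputable def condDeficiency (N : CausalNetwork n) (U : Machine) (star : Word → Word)
    (x : Fin n → Word) (j : Fin n) : EReal :=
  negLog (N.prob j (N.pa x j) (x j)) -
    ((K U (x j) (star (tuple (N.pa x j ++ [N.mech j]))) : ℝ) : EReal)

end CausalNetwork

end AlgCausal

/-!
The logarithm turns the joint probability into a sum, so the claim is the decomposition
`K(x_1, …, x_n ∣ P^*) = ∑_j K(x_j ∣ (pa_j, P_j)^*) + O(1)`.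

The chain rule `K(z) = K(b) + K(z ∣ b^*) + O(1)`, for `b` computable from `z`, gives
`K(x, P) = K(P) + K(x ∣ P^*) + O(1)`. It also gives strong subadditivity, and with it, along a
topological order, the inequality `K(w) ≤ ∑_v K(w_v ∣ pa_v^*) + O(1)` for all strings at the nodes
of an acyclic graph, and its version relative to the strings of an ancestor-closed set of nodes
(`exists_K_ancestral_le`). The relative version, for the mechanisms inside the augmented graph, is
`K(x, P) ≤ K(P) + S + O(1)` with `S = ∑_j K(x_j ∣ (pa_j, P_j)^*)`; hence `K(x ∣ P^*) ≤ S + O(1)`.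
Conversely `K(P) ≤ ∑_j K(P_j ∣ ε^*) + O(1)`, while the Markov condition says
`K(x, P) ≥ S + ∑_j K(P_j ∣ ε^*) - C`; hence `K(x ∣ P^*) ≥ S - O(1)` (`exists_abs_K_sub_sum_le`).
All constants depend on the graph, of which there are finitely many for each `n`.

The substance is the hard half of the chain rule (`exists_K_add_K_star_le`). It rests on the
Kraft–Chaitin theorem (`exists_K_le_of_kraft`), proved by giving consecutive intervals of `[0, 1)`
to the requests as they arrive, and on the coding theorem (`sum_le_two_pow_neg_K`). The
machines search for a stage of a computable test, built from computations with bounded running time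
(`exists_stages`), and tuples are decoded by exhaustive search.
-/

namespace AlgCausal

open Encodable

/-! ### Computability -/

section Computability

variable {α σ : Type*} [Primcodable α] [Primcodable σ]

theorem primrec_two_pow : Primrec (fun n : ℕ => 2 ^ n) := by
  refine (Primrec.nat_rec₁ (f := fun _ m => m * 2) 1
    (Primrec.nat_mul.comp Primrec.snd (Primrec.const 2)).to₂).of_eq fun n => ?_
  induction n with
  | zero => rfl
  | succ n ih => simp only [ih, pow_succ]

/-- A partial recursive function is the increasing union of its computations with bounded
running time. -/
theorem exists_stages {f : α →. σ} (hf : Partrec f) :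
    ∃ u : α → ℕ → Option σ, Computable₂ u ∧
      (∀ a x s t, s ≤ t → u a s = some x → u a t = some x) ∧
      ∀ a x, x ∈ f a ↔ ∃ t, u a t = some x := by
  obtain ⟨c, hc⟩ := Nat.Partrec.Code.exists_code.1 hf
  have mono : ∀ (a : α) (x : σ) (s t : ℕ), s ≤ t →
      (c.evaln s (encode a)).bind (decode (α := σ)) = some x →
      (c.evaln t (encode a)).bind (decode (α := σ)) = some x := by
    intro a x s t hst h
    obtain ⟨y, hy, hx⟩ := Option.bind_eq_some_iff.1 h
    exact Option.bind_eq_some_iff.2 ⟨y, Nat.Partrec.Code.evaln_mono hst hy, hx⟩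
  refine ⟨fun a t => (c.evaln t (encode a)).bind decode, ?_, mono, fun a x => ?_⟩
  · have h : Primrec fun q : α × ℕ => c.evaln q.2 (encode q.1) :=
      Nat.Partrec.Code.primrec_evaln.comp
        ((Primrec.snd.pair (Primrec.const c)).pair (Primrec.encode.comp Primrec.fst))
    exact (Primrec.option_bind h (Primrec.decode.comp Primrec.snd).to₂).to_comp
  · have key : ∀ y, (∃ t, c.evaln t (encode a) = some y) ↔ ∃ x ∈ f a, encode x = y := by
      intro y
      have := @Nat.Partrec.Code.evaln_complete c (encode a) y
      rw [hc] at this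
      simpa using this.symm
    constructor
    · intro hx
      obtain ⟨t, ht⟩ := (key _).2 ⟨x, hx, rfl⟩
      exact ⟨t, by simp [ht]⟩
    · rintro ⟨t, ht⟩
      obtain ⟨y, hy, hx⟩ := Option.bind_eq_some_iff.1 ht
      obtain ⟨x', hx', rfl⟩ := (key y).1 ⟨t, hy⟩
      simp only [encodek, Option.some.injEq] at hx
      exact hx ▸ hx'

/-- A computable injection has a partial recursive left inverse, found by exhaustive search. -/
theorem exists_partrec_leftInverse {e : α → σ} (he : Computable e)
    (hinj : Function.Injective e) : ∃ d : σ →. α, Partrec d ∧ ∀ a s, a ∈ d s ↔ e a = s := by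
  classical
  let R : σ → ℕ → Option α := fun s n =>
    (decode (α := α) n).bind fun a => bif decide (e a = s) then some a else none
  have hR : Computable₂ R := by
    refine Computable.option_bind (Computable.decode.comp Computable.snd) ?_
    refine Computable.cond ?_ (Computable.option_some.comp Computable.snd) (Computable.const none)
    exact Primrec.eq.decide.to_comp.comp (he.comp Computable.snd)
      (Computable.fst.comp Computable.fst)
  have hspec : ∀ s n a, R s n = some a → e a = s := by
    intro s n a h
    obtain ⟨b, _, hb⟩ := Option.bind_eq_some_iff.1 h
    by_cases h' : e b = s <;> simp_all
  refine ⟨fun s => Nat.rfindOpt (R s), Partrec.rfindOpt hR, fun a s => ⟨fun h => ?_, ?_⟩⟩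
  · obtain ⟨n, hn⟩ := Nat.rfindOpt_spec h
    exact hspec _ _ _ hn
  rintro rfl
  have hdom : (Nat.rfindOpt (R (e a))).Dom :=
    Nat.rfindOpt_dom.2 ⟨encode a, a, by simp [R]⟩
  obtain ⟨b, hb⟩ := Part.dom_iff_mem.1 hdom
  obtain ⟨n, hn⟩ := Nat.rfindOpt_spec hb
  obtain rfl := hinj (hspec _ _ _ hn)
  exact hb

/-- Whether a test succeeds at some stage before `t`. -/
def succeedsBefore {α : Type*} (A : α → ℕ → Bool) (a : α) (t : ℕ) : Bool :=
  Nat.rec false (fun i b => b || A a i) t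

theorem succeedsBefore_iff {α : Type*} {A : α → ℕ → Bool} {a : α} {t : ℕ} :
    succeedsBefore A a t = true ↔ ∃ i < t, A a i = true := by
  induction t with
  | zero => simp [succeedsBefore]
  | succ t ih =>
    have : succeedsBefore A a (t + 1) = (succeedsBefore A a t || A a t) := rfl
    rw [this, Bool.or_eq_true, ih]
    constructor
    · rintro (⟨i, hi, h⟩ | h)
      exacts [⟨i, by omega, h⟩, ⟨t, by omega, h⟩]
    · rintro ⟨i, hi, h⟩
      rcases Nat.lt_succ_iff_lt_or_eq.1 hi with h' | rfl
      exacts [Or.inl ⟨i, h', h⟩, Or.inr h]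

theorem computable_succeedsBefore {A : α → ℕ → Bool} (hA : Computable₂ A) :
    Computable₂ (succeedsBefore A) := by
  refine Computable.nat_rec (f := fun q : α × ℕ => q.2) (g := fun _ => false)
    (h := fun q ib => ib.2 || A q.1 ib.1) Computable.snd (Computable.const _) ?_
  refine Primrec.or.to_comp.comp (Computable.snd.comp Computable.snd) ?_
  exact hA.comp (Computable.fst.comp Computable.fst) (Computable.fst.comp Computable.snd)

end Computability

/-! ### Complexity and prefix-free machines -/

section Machines

variable {U : Machine}

theorem K_le_length {x y p : Word} (h : x ∈ U p y) : K U x y ≤ p.length :=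
  Nat.sInf_le ⟨p, h, rfl⟩

theorem length_star {star : Word → Word} (hstar : IsShortestProgramMap U star) (z : Word) :
    (star z).length = K U z [] := by
  refine le_antisymm ?_ (K_le_length (hstar z).1)
  refine le_csInf ⟨_, _, (hstar z).1, rfl⟩ ?_
  rintro _ ⟨p, hp, rfl⟩
  exact (hstar z).2 p hp

/-- The universal machine bounds the complexity by the program lengths of any prefix-free machine,
here presented by the results `R (p, y) n` that it finds for the program `p` at stage `n`. -/
theorem exists_K_le_of_stages (hU : IsUniversalPrefixMachine U) {R : Word × Word → ℕ → Option Word}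
    (hR : Computable₂ R)
    (hpf : ∀ y p q n m a b, R (p, y) n = some a → R (q, y) m = some b → p <+: q →
      p = q ∧ a = b) :
    ∃ c : ℕ, ∀ p y n x, R (p, y) n = some x → K U x y ≤ p.length + c := by
  have hV : IsPrefixMachine fun p y => Nat.rfindOpt (R (p, y)) := by
    refine ⟨Partrec.rfindOpt hR, fun y p q hp hq hpq => ?_⟩
    obtain ⟨n, a, ha⟩ := Nat.rfindOpt_dom.1 hp
    obtain ⟨m, b, hb⟩ := Nat.rfindOpt_dom.1 hq
    exact (hpf y p q n m a b ha hb hpq).1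
  obtain ⟨c, hc⟩ := hU.universal _ hV
  refine ⟨c, fun p y n x hx => ?_⟩
  have hdom : (Nat.rfindOpt (R (p, y))).Dom := Nat.rfindOpt_dom.2 ⟨n, x, hx⟩
  obtain ⟨x', hx'⟩ := Part.dom_iff_mem.1 hdom
  obtain ⟨m, hm⟩ := Nat.rfindOpt_spec hx'
  obtain rfl := (hpf y p p n m x x' hx hm (List.prefix_refl p)).2
  obtain ⟨q, hq, hlen⟩ := hc p y x hx'
  exact (K_le_length hq).trans hlen

theorem exists_K_le_of_machine (hU : IsUniversalPrefixMachine U) {V : Machine}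
    (hV : IsPrefixMachine V) : ∃ c : ℕ, ∀ p y x, x ∈ V p y → K U x y ≤ p.length + c := by
  obtain ⟨c, hc⟩ := hU.universal V hV
  refine ⟨c, fun p y x hx => ?_⟩
  obtain ⟨q, hq, hlen⟩ := hc p y x hx
  exact (K_le_length hq).trans hlen

end Machines

/-! ### Encoding of tuples -/

theorem selfDelim_append_inj {x y s t : Word} (h : selfDelim x ++ s = selfDelim y ++ t) :
    x = y ∧ s = t := by
  have key : ∀ (a b : ℕ) (u v : Word), List.replicate a true ++ false :: u =
      List.replicate b true ++ false :: v → a = b ∧ u = v := by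
    intro a
    induction a with
    | zero => rintro (_ | b) u v h <;> simp_all [List.replicate_succ]
    | succ a ih =>
      rintro (_ | b) u v h
      · simp [List.replicate_succ] at h
      · simpa [List.replicate_succ] using ih b u v (by simpa [List.replicate_succ] using h)
  obtain ⟨hl, h'⟩ := key x.length y.length (x ++ s) (y ++ t) (by simpa [selfDelim] using h)
  exact List.append_inj h' hl

theorem tuple_injective : Function.Injective tuple := by
  intro l
  induction l with
  | nil =>
    rintro (_ | ⟨b, m⟩) h
    · rfl
    · simp [tuple, selfDelim] at h
  | cons a l ih =>
    rintro (_ | ⟨b, m⟩) h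
    · simp [tuple, selfDelim] at h
    · obtain ⟨rfl, h'⟩ := selfDelim_append_inj (s := tuple l) (t := tuple m)
        (by simpa [tuple] using h)
      rw [ih h']

theorem primrec_selfDelim : Primrec selfDelim := by
  have h : Primrec fun x : Word => (List.range x.length).map (fun _ => true) :=
    Primrec.list_map (Primrec.list_range.comp Primrec.list_length) (Primrec.const true).to₂
  refine (Primrec.list_append.comp h
    (Primrec.list_cons.comp (Primrec.const false) Primrec.id)).of_eq fun x => ?_
  simp [selfDelim]

theorem computable_tuple : Computable tuple :=
  (Primrec.list_flatMap Primrec.id (primrec_selfDelim.comp Primrec.snd).to₂).to_comp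

/-! ### Dyadic intervals -/

/-- The natural number with binary expansion `p`, most significant bit first. -/
def binVal (p : Word) : ℕ := p.foldl (fun a b => 2 * a + b.toNat) 0

theorem binVal_append (p q : Word) : binVal (p ++ q) = binVal p * 2 ^ q.length + binVal q := by
  induction q using List.reverseRecOn with
  | nil => simp [binVal]
  | append_singleton q b ih =>
    have step : ∀ r : Word, binVal (r ++ [b]) = 2 * binVal r + b.toNat := fun r => by
      simp [binVal]
    rw [← List.append_assoc, step, step, ih, List.length_append, List.length_singleton, pow_succ]
    ring

theorem binVal_lt (p : Word) : binVal p < 2 ^ p.length := by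
  induction p using List.reverseRecOn with
  | nil => simp [binVal]
  | append_singleton q b ih =>
    have h : binVal [b] < 2 := by cases b <;> simp [binVal]
    simp only [binVal_append, List.length_append, List.length_singleton, pow_succ]
    omega

theorem exists_binVal_eq (m : ℕ) : ∀ k < 2 ^ m, ∃ p : Word, p.length = m ∧ binVal p = k := by
  induction m with
  | zero => exact fun k hk => ⟨[], rfl, by simp at hk; simp [binVal, hk]⟩
  | succ m ih =>
    intro k hk
    obtain ⟨p, hp, hv⟩ := ih (k / 2) (by rw [pow_succ] at hk; omega)
    refine ⟨p ++ [decide (k % 2 = 1)], by simp [hp], ?_⟩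
    rw [binVal_append, hv]
    rcases Nat.mod_two_eq_zero_or_one k with h | h <;> simp [binVal, h] <;> omega

theorem primrec_binVal : Primrec binVal := by
  have hb : Primrec Bool.toNat := Primrec.dom_finite _
  refine Primrec.list_foldl (h := fun _ (q : ℕ × Bool) => 2 * q.1 + q.2.toNat) Primrec.id
    (Primrec.const 0) ?_
  exact (Primrec.nat_add.comp
    (Primrec.nat_mul.comp (Primrec.const 2) (Primrec.fst.comp Primrec.snd))
    (hb.comp (Primrec.snd.comp Primrec.snd))).to₂

/-- The left end of the dyadic interval `[0.p, 0.p + 2^{-|p|})` of a word `p`. -/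
noncomputable def leftEnd (p : Word) : ℝ := binVal p * (1 / 2) ^ p.length

theorem leftEnd_append (p q : Word) :
    leftEnd (p ++ q) = leftEnd p + (1 / 2) ^ p.length * leftEnd q := by
  simp only [leftEnd, binVal_append, List.length_append, pow_add]
  push_cast
  have : (2 : ℝ) ^ q.length * (1 / 2) ^ q.length = 1 := by rw [← mul_pow]; norm_num
  linear_combination (binVal p : ℝ) * (1 / 2) ^ p.length * this

theorem leftEnd_nonneg (p : Word) : 0 ≤ leftEnd p := by unfold leftEnd; positivity

theorem leftEnd_add_le_one (p : Word) : leftEnd p + (1 / 2) ^ p.length ≤ 1 := by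
  have h : ((binVal p : ℝ) + 1) ≤ 2 ^ p.length := by exact_mod_cast binVal_lt p
  have h2 : (2 : ℝ) ^ p.length * (1 / 2) ^ p.length = 1 := by rw [← mul_pow]; norm_num
  unfold leftEnd
  nlinarith [pow_pos (show (0 : ℝ) < 1 / 2 by norm_num) p.length]

/-- The dyadic interval of an extension of `p` lies in that of `p`. -/
theorem interval_subset_of_prefix {p q : Word} (h : p <+: q) :
    leftEnd p ≤ leftEnd q ∧
      leftEnd q + (1 / 2) ^ q.length ≤ leftEnd p + (1 / 2) ^ p.length := by
  obtain ⟨r, rfl⟩ := h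
  have h0 := leftEnd_nonneg r
  have h1 := leftEnd_add_le_one r
  have hp := pow_pos (show (0 : ℝ) < 1 / 2 by norm_num) p.length
  rw [leftEnd_append, List.length_append, pow_add]
  constructor <;> nlinarith

/-! ### Online Kraft–Chaitin coding -/

/-- The weight `2^{-l}` of a request for a program of length `l`. -/
noncomputable def requestWeight : Option (ℕ × Word) → ℝ
  | none => 0
  | some e => (1 / 2) ^ e.1

theorem requestWeight_nonneg (o : Option (ℕ × Word)) : 0 ≤ requestWeight o := by
  rcases o with _ | e
  · exact le_rfl
  · simp only [requestWeight]; positivity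

/-- The total weight of the requests before stage `s`, multiplied by `2^s`. -/
def scaledWeight (r : ℕ → Option (ℕ × Word)) (s : ℕ) : ℕ :=
  Nat.rec 0 (fun i m => 2 * m + (r i).elim 0 fun e => 2 ^ (i + 1 - e.1)) s

theorem scaledWeight_eq {r : ℕ → Option (ℕ × Word)} (hr : ∀ s e, r s = some e → e.1 ≤ s) (s : ℕ) :
    (scaledWeight r s : ℝ) = 2 ^ s * ∑ i ∈ Finset.range s, requestWeight (r i) := by
  induction s with
  | zero => simp [scaledWeight]
  | succ s ih =>
    have h : scaledWeight r (s + 1) =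
      2 * scaledWeight r s + (r s).elim 0 fun e => 2 ^ (s + 1 - e.1) := rfl
    rw [h, Finset.sum_range_succ]
    push_cast
    rw [ih]
    rcases he : r s with _ | e
    · simp [requestWeight]; ring
    · have hle := hr s e he
      have h2 : (2 : ℝ) ^ (s + 1 - e.1) = 2 ^ (s + 1) * (1 / 2) ^ e.1 := by
        rw [pow_sub₀ _ two_ne_zero (by omega)]; simp
      simp [requestWeight, h2]; ring

/-- Requests for programs, arriving computably one by one and with total weight at most `1`, can
be served by a prefix-free machine with programs one bit longer than requested: the request at
stage `s` owns the interval from the weight of the earlier requests to the weight including it,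
which has length `2^{-l}` and so contains a dyadic interval of length `2^{-l-1}`. -/
theorem exists_K_le_of_requests {U : Machine} (hU : IsUniversalPrefixMachine U)
    {r : Word → ℕ → Option (ℕ × Word)} (hcomp : Computable₂ r)
    (hr : ∀ y s e, r y s = some e → e.1 ≤ s) :
    ∃ c : ℕ, ∀ y, (∀ s, ∑ i ∈ Finset.range s, requestWeight (r y i) ≤ 1) →
      ∀ s l x, r y s = some (l, x) → K U x y ≤ l + c := by
  classical
  -- `p` serves the request `e` of stage `s` if its dyadic interval has the right length and
  -- lies in the interval of that request, in integer arithmetic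
  let ok : (Word × Word) × ℕ → ℕ × Word → Bool := fun q e =>
    decide (q.1.1.length = e.1 + 1) &&
    (decide (scaledWeight (r q.1.2) q.2 * 2 ^ (e.1 + 1) ≤ binVal q.1.1 * 2 ^ q.2) &&
    decide ((binVal q.1.1 + 1) * 2 ^ q.2 ≤
      scaledWeight (r q.1.2) q.2 * 2 ^ (e.1 + 1) + 2 ^ (q.2 + 1)))
  let R : Word × Word → ℕ → Option Word := fun py s =>
    (r py.2 s).bind fun e => bif ok (py, s) e then some e.2 else none
  have hM : Computable₂ fun y s => scaledWeight (r y) s := by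
    refine Computable.nat_rec (f := fun q : Word × ℕ => q.2) (g := fun _ => 0)
      (h := fun q im => 2 * im.2 + (r q.1 im.1).elim 0 fun e => 2 ^ (im.1 + 1 - e.1))
      Computable.snd (Computable.const _) ?_
    refine Primrec.nat_add.to_comp.comp (Primrec.nat_mul.to_comp.comp (Computable.const 2)
      (Computable.snd.comp Computable.snd)) ?_
    have : Computable fun q : (Word × ℕ) × ℕ × ℕ =>
        Option.casesOn (motive := fun _ => ℕ) (r q.1.1 q.2.1) 0
          fun e => 2 ^ (q.2.1 + 1 - e.1) := by
      refine Computable.option_casesOn (hcomp.comp (Computable.fst.comp Computable.fst)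
        (Computable.fst.comp Computable.snd)) (Computable.const 0) ?_
      exact primrec_two_pow.to_comp.comp (Primrec.nat_sub.to_comp.comp
        (Computable.succ.comp (Computable.fst.comp (Computable.snd.comp Computable.fst)))
        (Computable.fst.comp Computable.snd))
    refine this.of_eq fun q => ?_
    cases r q.1.1 q.2.1 <;> rfl
  have hok : Computable₂ ok := by
    have c2 : Primrec fun l : ℕ => 2 ^ (l + 1) := primrec_two_pow.comp Primrec.succ
    have hl : Computable fun q : ((Word × Word) × ℕ) × (ℕ × Word) => q.2.1 :=
      Computable.fst.comp Computable.snd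
    have hp : Computable fun q : ((Word × Word) × ℕ) × (ℕ × Word) => q.1.1.1 :=
      Computable.fst.comp (Computable.fst.comp Computable.fst)
    have hs : Computable fun q : ((Word × Word) × ℕ) × (ℕ × Word) => q.1.2 :=
      Computable.snd.comp Computable.fst
    have hMs : Computable fun q : ((Word × Word) × ℕ) × (ℕ × Word) =>
        scaledWeight (r q.1.1.2) q.1.2 * 2 ^ (q.2.1 + 1) :=
      Primrec.nat_mul.to_comp.comp
        (hM.comp (Computable.snd.comp (Computable.fst.comp Computable.fst)) hs)
        (c2.to_comp.comp hl)
    have hv := primrec_binVal.to_comp.comp hp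
    refine Primrec.and.to_comp.comp ?_ (Primrec.and.to_comp.comp ?_ ?_)
    · exact Primrec.eq.decide.to_comp.comp (Computable.list_length.comp hp)
        (Computable.succ.comp hl)
    · exact Primrec.nat_le.decide.to_comp.comp hMs
        (Primrec.nat_mul.to_comp.comp hv (primrec_two_pow.to_comp.comp hs))
    · exact Primrec.nat_le.decide.to_comp.comp
        (Primrec.nat_mul.to_comp.comp (Computable.succ.comp hv) (primrec_two_pow.to_comp.comp hs))
        (Primrec.nat_add.to_comp.comp hMs (c2.to_comp.comp hs))
  have hR : Computable₂ R := by
    refine Computable.option_bind (hcomp.comp (Computable.snd.comp Computable.fst)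
      Computable.snd) ?_
    exact Computable.cond (hok.comp Computable.fst Computable.snd)
      (Computable.option_some.comp (Computable.snd.comp Computable.snd)) (Computable.const none)
  have hRsome : ∀ p y s x, R (p, y) s = some x ↔ ∃ l, r y s = some (l, x) ∧ p.length = l + 1 ∧
      scaledWeight (r y) s * 2 ^ (l + 1) ≤ binVal p * 2 ^ s ∧
      (binVal p + 1) * 2 ^ s ≤ scaledWeight (r y) s * 2 ^ (l + 1) + 2 ^ (s + 1) := by
    intro p y s x
    simp only [R, Option.bind_eq_some_iff, Prod.exists]
    constructor
    · rintro ⟨l, x', hr', h⟩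
      by_cases hc : ok ((p, y), s) (l, x') = true
      · simp only [hc, cond_true, Option.some.injEq] at h
        subst h
        refine ⟨l, hr', ?_⟩
        simpa only [ok, Bool.and_eq_true, decide_eq_true_eq] using hc
      · simp [hc] at h
    · rintro ⟨l, hr', h⟩
      refine ⟨l, x, hr', ?_⟩
      have hc : ok ((p, y), s) (l, x) = true := by
        simpa only [ok, Bool.and_eq_true, decide_eq_true_eq] using h
      simp [hc]
  -- the real form of the integer inequalities
  have hreal : ∀ p y s x, R (p, y) s = some x →
      ∑ i ∈ Finset.range s, requestWeight (r y i) ≤ leftEnd p ∧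
      leftEnd p + (1 / 2) ^ p.length ≤
        ∑ i ∈ Finset.range (s + 1), requestWeight (r y i) := by
    intro p y s x h
    obtain ⟨l, hl, hlen, h1, h2⟩ := (hRsome p y s x).1 h
    rw [Finset.sum_range_succ, hl]
    have hS := scaledWeight_eq (hr y) s
    set S := ∑ i ∈ Finset.range s, requestWeight (r y i)
    have h1' : (scaledWeight (r y) s : ℝ) * 2 ^ (l + 1) ≤ binVal p * 2 ^ s := by exact_mod_cast h1
    have h2' : ((binVal p : ℝ) + 1) * 2 ^ s ≤
      scaledWeight (r y) s * 2 ^ (l + 1) + 2 ^ (s + 1) := by exact_mod_cast h2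
    rw [hS] at h1' h2'
    have hs : (0 : ℝ) < 2 ^ s := by positivity
    have hl0 : (0 : ℝ) < (1 / 2) ^ (l + 1) := by positivity
    have hone : (2 : ℝ) ^ (l + 1) * (1 / 2) ^ (l + 1) = 1 := by rw [← mul_pow]; norm_num
    have h1'' : S * 2 ^ (l + 1) ≤ binVal p := by
      refine le_of_mul_le_mul_right ?_ hs; linarith
    have h2'' : (binVal p : ℝ) + 1 ≤ S * 2 ^ (l + 1) + 2 := by
      refine le_of_mul_le_mul_right ?_ hs; rw [pow_succ 2 s] at h2'; linarith
    have h1''' := mul_le_mul_of_nonneg_right h1'' hl0.le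
    have h2''' := mul_le_mul_of_nonneg_right h2'' hl0.le
    rw [mul_assoc, hone, mul_one] at h1'''
    rw [add_mul, add_mul, mul_assoc S, hone, one_mul, mul_one] at h2'''
    have hhalf : (2 : ℝ) * (1 / 2) ^ (l + 1) = (1 / 2) ^ l := by rw [pow_succ]; ring
    simp only [leftEnd, hlen, requestWeight]
    exact ⟨h1''', by linarith⟩
  have hmono : ∀ y, Monotone fun s => ∑ i ∈ Finset.range s, requestWeight (r y i) := fun y =>
    monotone_nat_of_le_succ fun s => by
      rw [Finset.sum_range_succ]
      exact le_add_of_nonneg_right (requestWeight_nonneg _)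
  obtain ⟨c, hc⟩ := exists_K_le_of_stages hU hR (by
    intro y p q n m a b ha hb hpq
    obtain ⟨p1, p2⟩ := hreal p y n a ha
    obtain ⟨q1, q2⟩ := hreal q y m b hb
    obtain ⟨i1, i2⟩ := interval_subset_of_prefix hpq
    have hq0 := pow_pos (show (0 : ℝ) < 1 / 2 by norm_num) q.length
    have hnm : n = m := by
      rcases lt_trichotomy n m with h | h | h
      · have := hmono y (Nat.succ_le_of_lt h)
        simp only [Nat.succ_eq_add_one] at this
        linarith
      · exact h
      · have := hmono y (Nat.succ_le_of_lt h)
        simp only [Nat.succ_eq_add_one] at this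
        linarith
    subst hnm
    obtain ⟨l, hl, hlen, -⟩ := (hRsome p y n a).1 ha
    obtain ⟨l', hl', hlen', -⟩ := (hRsome q y n b).1 hb
    rw [hl, Option.some.injEq, Prod.mk.injEq] at hl'
    obtain ⟨rfl, rfl⟩ := hl'
    exact ⟨hpq.eq_of_length (hlen.trans hlen'.symm), rfl⟩)
  refine ⟨c + 1, fun y hy s l x hx => ?_⟩
  have hls : l ≤ s := hr y s _ hx
  have hS := scaledWeight_eq (hr y) s
  have hsum := hy (s + 1)
  rw [Finset.sum_range_succ, hx, requestWeight] at hsum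
  set S := ∑ i ∈ Finset.range s, requestWeight (r y i)
  set M := scaledWeight (r y) s
  have hM1 : M + 2 ^ (s - l) ≤ 2 ^ s := by
    have : (M : ℝ) + 2 ^ (s - l) ≤ 2 ^ s := by
      rw [hS, pow_sub₀ _ two_ne_zero hls]
      have : (2 : ℝ) ^ s * (S + (1 / 2) ^ l) ≤ 2 ^ s * 1 :=
        mul_le_mul_of_nonneg_left hsum (by positivity)
      simpa [mul_add] using this
    exact_mod_cast this
  -- `k` is the least multiple of `2^{-l-1}` to the right of the left end `M / 2^s`
  obtain ⟨k, hk1, hk2⟩ : ∃ k, M * 2 ^ (l + 1) ≤ k * 2 ^ s ∧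
      k * 2 ^ s ≤ M * 2 ^ (l + 1) + 2 ^ s := by
    have hs : 0 < 2 ^ s := by positivity
    refine ⟨(M * 2 ^ (l + 1) + (2 ^ s - 1)) / 2 ^ s, ?_, ?_⟩
    · have h1 := Nat.div_add_mod (M * 2 ^ (l + 1) + (2 ^ s - 1)) (2 ^ s)
      have h2 := Nat.mod_lt (M * 2 ^ (l + 1) + (2 ^ s - 1)) hs
      rw [mul_comm] at h1
      omega
    · have h1 := Nat.div_mul_le_self (M * 2 ^ (l + 1) + (2 ^ s - 1)) (2 ^ s)
      omega
  have hk3 : (k + 1) * 2 ^ s ≤ M * 2 ^ (l + 1) + 2 ^ (s + 1) := by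
    rw [add_mul, pow_succ 2 s]; omega
  have hk : k < 2 ^ (l + 1) := by
    have e : 2 ^ (s - l) * 2 ^ (l + 1) = 2 ^ (s + 1) := by rw [← pow_add]; congr 1; omega
    have h1 : (M + 2 ^ (s - l)) * 2 ^ (l + 1) ≤ 2 ^ s * 2 ^ (l + 1) := Nat.mul_le_mul_right _ hM1
    rw [add_mul, e] at h1
    have h2 : (k + 1) * 2 ^ s ≤ 2 ^ (l + 1) * 2 ^ s := by
      rw [mul_comm (2 ^ (l + 1))]; exact hk3.trans h1
    exact Nat.le_of_mul_le_mul_right h2 (by positivity)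
  obtain ⟨p, hp, hv⟩ := exists_binVal_eq (l + 1) k hk
  have := hc p y s x ((hRsome p y s x).2 ⟨l, hx, hp, by rwa [hv], by rwa [hv]⟩)
  omega

/-- **Kraft–Chaitin theorem**, with side information `y`. The requests are the pairs `(l, x)`
accepted by a computable test at some stage; whenever they satisfy Kraft's inequality, each `x` has
complexity at most `l` up to a constant. -/
theorem exists_K_le_of_kraft {U : Machine} (hU : IsUniversalPrefixMachine U)
    {A : Word × ℕ × Word → ℕ → Bool} (hA : Computable₂ A) :
    ∃ c : ℕ, ∀ y, (∀ F : Finset (ℕ × Word), (∀ e ∈ F, ∃ t, A (y, e) t = true) →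
      ∑ e ∈ F, (1 / 2 : ℝ) ^ e.1 ≤ 1) →
      ∀ l x, (∃ t, A (y, l, x) t = true) → K U x y ≤ l + c := by
  classical
  -- at stage `encode (e, t)`, the request `e` is issued if `t` is the first stage accepting it
  let r : Word → ℕ → Option (ℕ × Word) := fun y s =>
    (decode₂ ((ℕ × Word) × ℕ) s).bind fun e =>
      bif A (y, e.1) e.2 && !succeedsBefore A (y, e.1) e.2 then some e.1 else none
  have hr : Computable₂ r := by
    refine Computable.option_bind (Primrec.decode₂.to_comp.comp Computable.snd) ?_
    have ha : Computable fun q : (Word × ℕ) × (ℕ × Word) × ℕ => (q.1.1, q.2.1) :=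
      (Computable.fst.comp Computable.fst).pair (Computable.fst.comp Computable.snd)
    have ht : Computable fun q : (Word × ℕ) × (ℕ × Word) × ℕ => q.2.2 :=
      Computable.snd.comp Computable.snd
    refine Computable.cond (Primrec.and.to_comp.comp (hA.comp ha ht)
      (Primrec.not.to_comp.comp ((computable_succeedsBefore hA).comp ha ht)))
      (Computable.option_some.comp (Computable.fst.comp Computable.snd)) (Computable.const none)
  have hrsome : ∀ y s e, r y s = some e ↔ ∃ t, encode (e, t) = s ∧ A (y, e) t = true ∧
      ∀ i < t, ¬ A (y, e) i = true := by
    intro y s e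
    simp only [r, Option.bind_eq_some_iff]
    constructor
    · rintro ⟨⟨e', t⟩, he, h⟩
      by_cases hc : (A (y, e') t && !succeedsBefore A (y, e') t) = true
      · simp only [hc, cond_true, Option.some.injEq] at h
        subst h
        refine ⟨t, mem_decode₂.1 he, ?_⟩
        simp only [Bool.and_eq_true, Bool.not_eq_true'] at hc
        refine ⟨hc.1, fun i hi hA' => ?_⟩
        have := succeedsBefore_iff.2 ⟨i, hi, hA'⟩
        rw [hc.2] at this
        cases this
      · simp [hc] at h
    · rintro ⟨t, hs, h1, h2⟩
      refine ⟨(e, t), mem_decode₂.2 hs, ?_⟩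
      have : succeedsBefore A (y, e) t = false := by
        rw [← Bool.not_eq_true, succeedsBefore_iff]
        rintro ⟨i, hi, h⟩
        exact h2 i hi h
      simp [h1, this]
  obtain ⟨c, hc⟩ := exists_K_le_of_requests hU hr (by
    intro y s e he
    obtain ⟨t, rfl, -⟩ := (hrsome y s e).1 he
    rw [encode_prod_val, encode_prod_val]
    exact (Nat.left_le_pair _ _).trans (Nat.left_le_pair _ _))
  refine ⟨c, fun y hy l x hx => ?_⟩
  obtain ⟨s, hs⟩ : ∃ s, r y s = some (l, x) :=
    ⟨_, (hrsome y _ _).2 ⟨Nat.find hx, rfl, Nat.find_spec hx, fun i hi => Nat.find_min hx hi⟩⟩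
  refine hc y (fun n => ?_) s l x hs
  -- every request is issued only once
  have hinj : ∀ i j e, r y i = some e → r y j = some e → i = j := by
    intro i j e hi hj
    obtain ⟨t, rfl, ht, ht'⟩ := (hrsome y i e).1 hi
    obtain ⟨u, rfl, hu, hu'⟩ := (hrsome y j e).1 hj
    have : t = u := le_antisymm (not_lt.1 fun h => ht' u h hu) (not_lt.1 fun h => hu' t h ht)
    rw [this]
  have hsum : ∀ n, ∃ F : Finset (ℕ × Word), (∀ e ∈ F, ∃ i < n, r y i = some e) ∧
      ∑ i ∈ Finset.range n, requestWeight (r y i) = ∑ e ∈ F, (1 / 2 : ℝ) ^ e.1 := by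
    intro n
    induction n with
    | zero => exact ⟨∅, by simp⟩
    | succ n ih =>
      obtain ⟨F, hF, hsum⟩ := ih
      rcases hn : r y n with _ | e
      · refine ⟨F, fun e he => ?_, ?_⟩
        · obtain ⟨i, hi, h⟩ := hF e he
          exact ⟨i, by omega, h⟩
        · rw [Finset.sum_range_succ, hsum, hn]; simp [requestWeight]
      · have heF : e ∉ F := fun he => by
          obtain ⟨i, hi, h⟩ := hF e he
          exact absurd (hinj i n e h hn) (by omega)
        refine ⟨insert e F, fun e' he' => ?_, ?_⟩
        · rcases Finset.mem_insert.1 he' with rfl | he'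
          · exact ⟨n, by omega, hn⟩
          · obtain ⟨i, hi, h⟩ := hF e' he'
            exact ⟨i, by omega, h⟩
        · rw [Finset.sum_range_succ, hsum, hn, Finset.sum_insert heF, add_comm]; rfl
  obtain ⟨F, hF, hsum⟩ := hsum n
  rw [hsum]
  refine hy F fun e he => ?_
  obtain ⟨i, -, h⟩ := hF e he
  obtain ⟨t, -, ht, -⟩ := (hrsome y i e).1 h
  exact ⟨t, ht⟩

/-! ### The coding theorem and symmetry of information -/

theorem uniquelyDecodable_of_prefixFree {S : Set Word} (hnil : [] ∉ S)
    (hS : ∀ p ∈ S, ∀ q ∈ S, p <+: q → p = q) : InformationTheory.UniquelyDecodable S := by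
  intro L₁
  induction L₁ with
  | nil =>
    rintro (_ | ⟨q, L₂⟩) _ h₂ h
    · rfl
    · have hq : q = [] := by simp at h; exact h.1
      exact absurd (hq ▸ h₂ q (by simp)) hnil
  | cons p L₁ ih =>
    rintro (_ | ⟨q, L₂⟩) h₁ h₂ h
    · have hp : p = [] := by simp at h; exact h.1
      exact absurd (hp ▸ h₁ p (by simp)) hnil
    · have hp := h₁ p (by simp)
      have hq := h₂ q (by simp)
      simp only [List.flatten_cons] at h
      have hpq : p = q := by
        rcases List.prefix_or_prefix_of_prefix (List.prefix_append p L₁.flatten)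
          (h ▸ List.prefix_append q L₂.flatten) with h' | h'
        exacts [hS p hp q hq h', (hS q hq p hp h').symm]
      subst hpq
      rw [ih L₂ (fun w hw => h₁ w (by simp [hw])) (fun w hw => h₂ w (by simp [hw]))
        (List.append_cancel_left h)]

/-- Kraft's inequality for prefix-free sets. -/
theorem kraft_of_prefixFree (F : Finset Word) (hF : ∀ p ∈ F, ∀ q ∈ F, p <+: q → p = q) :
    ∑ p ∈ F, (1 / 2 : ℝ) ^ p.length ≤ 1 := by
  by_cases hnil : [] ∈ F
  · have : F = {[]} := Finset.eq_singleton_iff_unique_mem.2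
      ⟨hnil, fun q hq => (hF [] hnil q hq List.nil_prefix).symm⟩
    simp [this]
  · have := InformationTheory.kraft_mcmillan_inequality (S := F)
      (uniquelyDecodable_of_prefixFree (S := F) hnil hF)
    simpa using this

theorem sum_half_pow_le {S : Finset ℕ} {q : ℝ} (hq : 0 ≤ q)
    (hS : ∀ k ∈ S, 2 * (1 / 2 : ℝ) ^ k ≤ q) : ∑ k ∈ S, (1 / 2 : ℝ) ^ k ≤ q := by
  rcases S.eq_empty_or_nonempty with rfl | hne
  · simpa using hq
  · refine le_trans ?_ (hS _ (S.min'_mem hne))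
    have hsub : S ⊆ Finset.Ico (S.min' hne) (S.max' hne + 1) := fun k hk =>
      Finset.mem_Ico.2 ⟨S.min'_le k hk, Nat.lt_succ_of_le (S.le_max' k hk)⟩
    refine (Finset.sum_le_sum_of_subset_of_nonneg hsub fun _ _ _ => by positivity).trans ?_
    rw [geom_sum_Ico' (by norm_num) ((S.min'_le _ (S.max'_mem hne)).trans (Nat.le_succ _))]
    have : (0 : ℝ) < (1 / 2) ^ (S.max' hne).succ := by positivity
    rw [show (1 - 1 / 2 : ℝ) = 1 / 2 by norm_num, div_le_iff₀ (by norm_num)]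
    linarith

/-- The total weight of the words with code below `n` on which `u` outputs `b` by stage `t`,
multiplied by `2^t`. -/
def scaledMass (u : Word → ℕ → Option Word) (b : Word) (t n : ℕ) : ℕ :=
  Nat.rec 0 (fun i m => m + (decode₂ Word i).elim 0 fun p =>
    bif decide (u p t = some b) then 2 ^ (t - p.length) else 0) n

theorem computable_scaledMass {u : Word → ℕ → Option Word} (hu : Computable₂ u) :
    Computable fun q : Word × ℕ => scaledMass u q.1 q.2 q.2 := by
  refine Computable.nat_rec (f := fun q : Word × ℕ => q.2) (g := fun _ => 0)
    (h := fun q im => im.2 + (decode₂ Word im.1).elim 0 fun p =>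
      bif decide (u p q.2 = some q.1) then 2 ^ (q.2 - p.length) else 0)
    Computable.snd (Computable.const _) ?_
  refine Primrec.nat_add.to_comp.comp (Computable.snd.comp Computable.snd) ?_
  have : Computable fun q : (Word × ℕ) × ℕ × ℕ =>
      Option.casesOn (motive := fun _ => ℕ) (decode₂ Word q.2.1) 0 fun p =>
        bif decide (u p q.1.2 = some q.1.1) then 2 ^ (q.1.2 - p.length) else 0 := by
    refine Computable.option_casesOn
      (Primrec.decode₂.to_comp.comp (Computable.fst.comp Computable.snd)) (Computable.const 0) ?_
    have ht : Computable fun q : ((Word × ℕ) × ℕ × ℕ) × Word => q.1.1.2 :=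
      Computable.snd.comp (Computable.fst.comp Computable.fst)
    refine Computable.cond (Primrec.eq.decide.to_comp.comp (hu.comp Computable.snd ht)
      (Computable.option_some.comp (Computable.fst.comp (Computable.fst.comp Computable.fst))))
      (primrec_two_pow.to_comp.comp (Primrec.nat_sub.to_comp.comp ht
        (Computable.list_length.comp Computable.snd))) (Computable.const 0)
  refine this.of_eq fun q => ?_
  cases decode₂ Word q.2.1 <;> rfl

theorem scaledMass_eq (u : Word → ℕ → Option Word) (b : Word) (t n : ℕ) (hn : n ≤ t) :
    ∃ W : Finset Word, (∀ p, p ∈ W ↔ encode p < n ∧ u p t = some b) ∧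
      (scaledMass u b t n : ℝ) = 2 ^ t * ∑ p ∈ W, (1 / 2 : ℝ) ^ p.length := by
  induction n with
  | zero => exact ⟨∅, by simp, by simp [scaledMass]⟩
  | succ n ih =>
    obtain ⟨W, hW, hsum⟩ := ih (by omega)
    have hstep : scaledMass u b t (n + 1) = scaledMass u b t n + (decode₂ Word n).elim 0 fun p =>
      bif decide (u p t = some b) then 2 ^ (t - p.length) else 0 := rfl
    by_cases h : ∃ p : Word, encode p = n ∧ u p t = some b
    · obtain ⟨p, rfl, hp⟩ := h
      have hpW : p ∉ W := fun h => lt_irrefl _ ((hW p).1 h).1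
      refine ⟨insert p W, fun q => ?_, ?_⟩
      · rw [Finset.mem_insert, hW, Nat.lt_succ_iff_lt_or_eq]
        constructor
        · rintro (rfl | ⟨h1, h2⟩)
          exacts [⟨Or.inr rfl, hp⟩, ⟨Or.inl h1, h2⟩]
        · rintro ⟨h1 | h1, h2⟩
          exacts [Or.inr ⟨h1, h2⟩, Or.inl (encode_injective h1)]
      · have hlen : p.length ≤ t := (length_le_encode p).trans (by omega)
        rw [hstep, Finset.sum_insert hpW]
        push_cast
        rw [hsum, encodek₂]
        simp [hp, pow_sub₀ (2 : ℝ) two_ne_zero hlen]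
        ring
    · refine ⟨W, fun q => ?_, ?_⟩
      · rw [hW, Nat.lt_succ_iff_lt_or_eq]
        exact ⟨fun ⟨h1, h2⟩ => ⟨Or.inl h1, h2⟩, fun ⟨h1, h2⟩ =>
          ⟨h1.resolve_right fun h1 => h ⟨q, h1, h2⟩, h2⟩⟩
      · rw [hstep]
        push_cast
        rw [hsum]
        rcases hd : decode₂ Word n with _ | p
        · simp
        · have : ¬ u p t = some b := fun hp => h ⟨p, mem_decode₂.1 hd, hp⟩
          simp [this]

/-- **Coding theorem**: if `φ` has a prefix-free domain, the total weight of the words that `φ` maps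
to `b` exceeds `2^{-K(b)}` at most by a constant factor. A word `b` is requested with length `k` as
soon as the weight found so far reaches `2 · 2^{-k}`, so the requests for `b` weigh at most as much
as the words that `φ` maps to `b`. -/
theorem sum_le_two_pow_neg_K {U : Machine} (hU : IsUniversalPrefixMachine U) {φ : Word →. Word}
    (hφ : Partrec φ) (hpf : ∀ p q, (φ p).Dom → (φ q).Dom → p <+: q → p = q) :
    ∃ c : ℕ, ∀ b (F : Finset Word), (∀ p ∈ F, b ∈ φ p) →
      ∑ p ∈ F, (1 / 2 : ℝ) ^ p.length ≤ 2 ^ c * (1 / 2) ^ K U b [] := by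
  classical
  obtain ⟨u, hu, hmono, hspec⟩ := exists_stages hφ
  choose W hW hsum using fun b t => scaledMass_eq u b t t le_rfl
  have hWmono : ∀ b s t, s ≤ t → W b s ⊆ W b t := fun b s t hst p hp => by
    rw [hW] at hp ⊢
    exact ⟨by omega, hmono p b s t hst hp.2⟩
  have hWφ : ∀ b t, ∀ p ∈ W b t, b ∈ φ p := fun b t p hp => (hspec p b).2 ⟨t, ((hW b t p).1 hp).2⟩
  let A : Word × ℕ × Word → ℕ → Bool := fun e t =>
    decide (2 ^ (t + 1) ≤ scaledMass u e.2.2 t t * 2 ^ e.2.1)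
  have hA : Computable₂ A := by
    have hm : Computable fun q : (Word × ℕ × Word) × ℕ => scaledMass u q.1.2.2 q.2 q.2 :=
      (computable_scaledMass hu).comp (g := fun q : (Word × ℕ × Word) × ℕ => (q.1.2.2, q.2))
        ((Computable.snd.comp (Computable.snd.comp Computable.fst)).pair Computable.snd)
    have hl : Computable fun q : (Word × ℕ × Word) × ℕ => 2 ^ q.1.2.1 :=
      primrec_two_pow.to_comp.comp (Computable.fst.comp (Computable.snd.comp Computable.fst))
    have ht : Computable fun q : (Word × ℕ × Word) × ℕ => 2 ^ (q.2 + 1) :=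
      primrec_two_pow.to_comp.comp (Computable.succ.comp Computable.snd)
    exact Primrec.nat_le.decide.to_comp.comp ht (Primrec.nat_mul.to_comp.comp hm hl)
  have hAiff : ∀ y k b t, A (y, k, b) t = true ↔
      2 * (1 / 2 : ℝ) ^ k ≤ ∑ p ∈ W b t, (1 / 2 : ℝ) ^ p.length := by
    intro y k b t
    have h1 : A (y, k, b) t = true ↔
        (2 : ℝ) ^ (t + 1) ≤ (scaledMass u b t t : ℝ) * 2 ^ k := by
      simp only [A, decide_eq_true_eq]
      exact_mod_cast Iff.rfl
    have ht : (0 : ℝ) < 2 ^ t := by positivity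
    have hk : (0 : ℝ) < 2 ^ k := by positivity
    rw [h1, hsum, pow_succ, mul_assoc, mul_le_mul_iff_right₀ ht, one_div, inv_pow,
      ← div_eq_mul_inv, div_le_iff₀ hk]
  obtain ⟨c, hc⟩ := exists_K_le_of_kraft hU hA
  have hkraft : ∀ F : Finset (ℕ × Word), (∀ e ∈ F, ∃ t, A ([], e) t = true) →
      ∑ e ∈ F, (1 / 2 : ℝ) ^ e.1 ≤ 1 := by
    intro F hF
    choose! τ hτ using hF
    -- a stage by which all requests in `F` have been made
    let T := F.sup τ
    rw [← Finset.sum_fiberwise_of_maps_to (g := Prod.snd) (t := F.image Prod.snd)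
      (fun e he => Finset.mem_image_of_mem _ he)]
    have hfib : ∀ b ∈ F.image Prod.snd, ∑ e ∈ F with e.2 = b, (1 / 2 : ℝ) ^ e.1 ≤
        ∑ p ∈ W b T, (1 / 2 : ℝ) ^ p.length := by
      intro b _
      rw [← Finset.sum_image (f := fun k : ℕ => (1 / 2 : ℝ) ^ k) (g := Prod.fst)]
      · refine sum_half_pow_le (Finset.sum_nonneg fun _ _ => by positivity) fun k hk => ?_
        obtain ⟨⟨k', b'⟩, he, rfl⟩ := Finset.mem_image.1 hk
        obtain ⟨heF, rfl⟩ := Finset.mem_filter.1 he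
        refine ((hAiff _ _ _ _).1 (hτ _ heF)).trans ?_
        exact Finset.sum_le_sum_of_subset_of_nonneg
          (hWmono _ _ _ (Finset.le_sup (f := τ) heF)) fun _ _ _ => by positivity
      · rintro ⟨k, b'⟩ h1 ⟨k', b''⟩ h2 h
        simp only [Finset.coe_filter, Set.mem_ofPred_eq] at h1 h2 h
        rw [h, h1.2, h2.2]
    refine (Finset.sum_le_sum hfib).trans ?_
    rw [← Finset.sum_biUnion]
    · refine kraft_of_prefixFree _ fun p hp q hq => ?_
      obtain ⟨b, -, hp⟩ := Finset.mem_biUnion.1 hp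
      obtain ⟨b', -, hq⟩ := Finset.mem_biUnion.1 hq
      exact hpf p q (Part.dom_iff_mem.2 ⟨b, hWφ _ _ _ hp⟩) (Part.dom_iff_mem.2 ⟨b', hWφ _ _ _ hq⟩)
    · intro b _ b' _ hbb'
      refine Finset.disjoint_left.2 fun p hp hp' => hbb' ?_
      exact Part.mem_unique (hWφ _ _ _ hp) (hWφ _ _ _ hp')
  refine ⟨c + 2, fun b F hF => ?_⟩
  rcases F.eq_empty_or_nonempty with rfl | hne
  · simp
  set q := ∑ p ∈ F, (1 / 2 : ℝ) ^ p.length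
  have hq0 : 0 < q := Finset.sum_pos (fun _ _ => by positivity) hne
  have hq1 : q ≤ 1 := kraft_of_prefixFree F fun p hp p' hp' =>
    hpf p p' (Part.dom_iff_mem.2 ⟨b, hF p hp⟩) (Part.dom_iff_mem.2 ⟨b, hF p' hp'⟩)
  -- `k` is the least length with which `b` is requested
  have hex : ∃ k : ℕ, 2 * (1 / 2 : ℝ) ^ k ≤ q := by
    obtain ⟨k, hk⟩ := exists_pow_lt_of_lt_one (half_pos hq0) (show (1 / 2 : ℝ) < 1 by norm_num)
    exact ⟨k, by linarith⟩
  have hk := Nat.find_spec hex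
  set k := Nat.find hex with hkdef
  have hk1 : q < 4 * (1 / 2 : ℝ) ^ k := by
    rcases Nat.eq_zero_or_pos k with h0 | hpos
    · rw [h0, pow_zero]; linarith
    · have := not_le.1 (Nat.find_min hex (m := k - 1) (by omega))
      obtain ⟨j, hj⟩ : ∃ j, k = j + 1 := ⟨k - 1, by omega⟩
      rw [hj, Nat.add_sub_cancel] at this
      rw [hj, pow_succ]
      linarith
  choose! τ hτ using fun p hp => (hspec p b).1 (hF p hp)
  let T := max (F.sup τ) (F.sup encode + 1)
  have hsub : F ⊆ W b T := fun p hp => (hW b T p).2 ⟨by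
      have := Finset.le_sup (f := encode) hp
      exact lt_of_lt_of_le (Nat.lt_succ_of_le this) (le_max_right _ _),
    hmono p b _ T ((Finset.le_sup (f := τ) hp).trans (le_max_left _ _)) (hτ p hp)⟩
  have hKle := hc [] hkraft k b ⟨T, (hAiff _ _ _ _).2 (hk.trans
    (Finset.sum_le_sum_of_subset_of_nonneg hsub fun _ _ _ => by positivity))⟩
  have h2 : (1 / 2 : ℝ) ^ (k + c) ≤ (1 / 2) ^ K U b [] :=
    pow_le_pow_of_le_one (by norm_num) (by norm_num) hKle
  have h3 : (2 : ℝ) ^ c * (1 / 2) ^ c = 1 := by rw [← mul_pow]; norm_num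
  calc q ≤ 4 * (1 / 2 : ℝ) ^ k := hk1.le
    _ = 2 ^ (c + 2) * (1 / 2) ^ (k + c) := by
      rw [pow_add, pow_add]; linear_combination (-4) * (1 / 2 : ℝ) ^ k * h3
    _ ≤ _ := by gcongr

/-- **Symmetry of information**, the hard half: if `b` is computable from `z`, a shortest program of
`b` saves `K(b)` bits in describing `z`. Each program `p` of some `z'` with `f z' = b` gives a
request for `z'` of length `|p| - K(b)` up to a constant, which the coding theorem chooses so that
Kraft's inequality holds. -/
theorem exists_K_add_K_star_le {U : Machine} (hU : IsUniversalPrefixMachine U)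
    {star : Word → Word} (hstar : IsShortestProgramMap U star) {f : Word →. Word}
    (hf : Partrec f) :
    ∃ c : ℕ, ∀ z b, b ∈ f z → K U b [] + K U z (star b) ≤ K U z [] + c := by
  classical
  have hU0 : Partrec fun p => U p [] :=
    hU.isPrefixMachine.partrec.comp Computable.id (Computable.const [])
  have hφ : Partrec fun p => (U p []).bind f := hU0.bind (hf.comp Computable.snd).to₂
  obtain ⟨c₁, hc₁⟩ := sum_le_two_pow_neg_K hU hφ fun p q hp hq =>
    hU.isPrefixMachine.prefixFree [] p q hp.fst hq.fst
  obtain ⟨u, hu, humono, huspec⟩ := exists_stages hU0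
  obtain ⟨v, hv, hvmono, hvspec⟩ := exists_stages hφ
  -- the stage encodes the program `p` and the output `b` of `y` that justify the request `(l, z)`
  -- with side information `y`, and a running time
  let A : Word × ℕ × Word → ℕ → Bool := fun e t =>
    (decode (α := Word × Word × ℕ) t).elim false fun w =>
      decide (u w.1 w.2.2 = some e.2.2) && (decide (v w.1 w.2.2 = some w.2.1) &&
        (decide (u e.1 w.2.2 = some w.2.1) && decide (w.1.length + c₁ = e.2.1 + e.1.length)))
  have hA : Computable₂ A := by
    have : Computable fun q : (Word × ℕ × Word) × ℕ =>
        Option.casesOn (motive := fun _ => Bool) (decode (α := Word × Word × ℕ) q.2) false fun w =>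
          decide (u w.1 w.2.2 = some q.1.2.2) && (decide (v w.1 w.2.2 = some w.2.1) &&
            (decide (u q.1.1 w.2.2 = some w.2.1) &&
              decide (w.1.length + c₁ = q.1.2.1 + q.1.1.length))) := by
      refine Computable.option_casesOn (Computable.decode.comp Computable.snd)
        (Computable.const false) ?_
      have hp : Computable fun q : ((Word × ℕ × Word) × ℕ) × Word × Word × ℕ => q.2.1 :=
        Computable.fst.comp Computable.snd
      have hb : Computable fun q : ((Word × ℕ × Word) × ℕ) × Word × Word × ℕ =>
          some q.2.2.1 :=
        Computable.option_some.comp (Computable.fst.comp (Computable.snd.comp Computable.snd))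
      have hs : Computable fun q : ((Word × ℕ × Word) × ℕ) × Word × Word × ℕ => q.2.2.2 :=
        Computable.snd.comp (Computable.snd.comp Computable.snd)
      have he : Computable fun q : ((Word × ℕ × Word) × ℕ) × Word × Word × ℕ => q.1.1 :=
        Computable.fst.comp Computable.fst
      have hy := Computable.fst.comp he
      refine Primrec.and.to_comp.comp (Primrec.eq.decide.to_comp.comp (hu.comp hp hs)
        (Computable.option_some.comp (Computable.snd.comp (Computable.snd.comp he))))
        (Primrec.and.to_comp.comp (Primrec.eq.decide.to_comp.comp (hv.comp hp hs) hb)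
        (Primrec.and.to_comp.comp (Primrec.eq.decide.to_comp.comp (hu.comp hy hs) hb)
        (Primrec.eq.decide.to_comp.comp ?_ ?_)))
      · exact Primrec.nat_add.to_comp.comp (Computable.list_length.comp hp) (Computable.const c₁)
      · exact Primrec.nat_add.to_comp.comp (Computable.fst.comp (Computable.snd.comp he))
          (Computable.list_length.comp hy)
    refine this.of_eq fun q => ?_
    simp only [A]
    cases decode (α := Word × Word × ℕ) q.2 <;> rfl
  obtain ⟨c₂, hc₂⟩ := exists_K_le_of_kraft hU hA
  refine ⟨c₁ + c₂, fun z b hb => ?_⟩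
  have hy := (hstar b).1
  have hylen := length_star hstar b
  set y := star b
  have hone : (2 : ℝ) ^ y.length * (1 / 2) ^ y.length = 1 := by rw [← mul_pow]; norm_num
  have hone' : (2 : ℝ) ^ c₁ * (1 / 2) ^ c₁ = 1 := by rw [← mul_pow]; norm_num
  have hkraft : ∀ F : Finset (ℕ × Word), (∀ e ∈ F, ∃ t, A (y, e) t = true) →
      ∑ e ∈ F, (1 / 2 : ℝ) ^ e.1 ≤ 1 := by
    intro F hF
    have hF' : ∀ e ∈ F, ∃ p, e.2 ∈ U p [] ∧ b ∈ (U p []).bind f ∧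
        p.length + c₁ = e.1 + y.length := by
      intro e he
      obtain ⟨t, ht⟩ := hF e he
      simp only [A] at ht
      rcases hd : decode (α := Word × Word × ℕ) t with _ | ⟨p, b', s⟩
      · simp [hd] at ht
      · simp only [hd, Option.elim_some, Bool.and_eq_true, decide_eq_true_eq] at ht
        obtain ⟨h1, h2, h3, h4⟩ := ht
        have hb' : b' = b := Part.mem_unique ((huspec y b').2 ⟨s, h3⟩) hy
        exact ⟨p, (huspec p _).2 ⟨s, h1⟩, (hvspec p b).2 ⟨s, hb' ▸ h2⟩, h4⟩
    choose! π hπ1 hπ2 hπ3 using hF'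
    have hinj : Set.InjOn π F := by
      rintro ⟨l, x⟩ he ⟨l', x'⟩ he' h
      have h1 := hπ1 _ he
      have h3 := hπ3 _ he
      rw [h] at h1 h3
      have hx : x = x' := Part.mem_unique h1 (hπ1 _ he')
      have hl : l = l' := by have := hπ3 _ he'; simp only at this h3; omega
      rw [hx, hl]
    have hweight : ∀ e ∈ F, (1 / 2 : ℝ) ^ e.1 =
        2 ^ y.length * (1 / 2) ^ c₁ * (1 / 2) ^ (π e).length := by
      intro e he
      have : (1 / 2 : ℝ) ^ (π e).length * (1 / 2) ^ c₁ = (1 / 2) ^ e.1 * (1 / 2) ^ y.length := by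
        rw [← pow_add, ← pow_add, hπ3 e he]
      linear_combination (-(1 / 2 : ℝ) ^ e.1) * hone - 2 ^ y.length * this
    rw [Finset.sum_congr rfl hweight, ← Finset.mul_sum,
      ← Finset.sum_image (f := fun p : Word => (1 / 2 : ℝ) ^ p.length) hinj]
    have hbound := hc₁ b (F.image π) fun p hp => by
      obtain ⟨e, he, rfl⟩ := Finset.mem_image.1 hp
      exact hπ2 e he
    rw [← hylen] at hbound
    calc _ ≤ 2 ^ y.length * (1 / 2 : ℝ) ^ c₁ * (2 ^ c₁ * (1 / 2) ^ y.length) := by gcongr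
      _ = 1 := by linear_combination (2 : ℝ) ^ c₁ * (1 / 2) ^ c₁ * hone + hone'
  have hz := (hstar z).1
  have hzφ : b ∈ (U (star z) []).bind f := Part.mem_bind hz hb
  -- the coding theorem, for the program `star z` alone, shows that the requested length is
  -- not negative
  have hle : y.length ≤ (star z).length + c₁ := by
    have h := hc₁ b {star z} (by simpa using hzφ)
    rw [Finset.sum_singleton, ← hylen] at h
    have h' : (1 / 2 : ℝ) ^ ((star z).length + c₁) ≤ (1 / 2) ^ y.length := by
      rw [pow_add]
      calc _ ≤ 2 ^ c₁ * (1 / 2 : ℝ) ^ y.length * (1 / 2) ^ c₁ := by gcongr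
        _ = _ := by linear_combination (1 / 2 : ℝ) ^ y.length * hone'
    exact (pow_le_pow_iff_right_of_lt_one₀ (by norm_num) (by norm_num)).1 h'
  obtain ⟨s₁, h₁⟩ := (huspec _ _).1 hz
  obtain ⟨s₂, h₂⟩ := (hvspec _ _).1 hzφ
  obtain ⟨s₃, h₃⟩ := (huspec _ _).1 hy
  let s := max s₁ (max s₂ s₃)
  have hreq := hc₂ y hkraft ((star z).length + c₁ - y.length) z
    ⟨encode (star z, b, s), by
      simp only [A, encodek, Option.elim_some, Bool.and_eq_true, decide_eq_true_eq]
      exact ⟨humono _ _ s₁ s (by omega) h₁, hvmono _ _ s₂ s (by omega) h₂,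
        humono _ _ s₃ s (by omega) h₃, by omega⟩⟩
  rw [← hylen, ← length_star hstar z]
  omega

/-! ### Elementary inequalities for the complexity -/

section Elementary

variable {U : Machine}

theorem exists_program (hU : IsUniversalPrefixMachine U) (x y : Word) :
    ∃ p, x ∈ U p y ∧ p.length = K U x y := by
  obtain ⟨d, hd, hspec⟩ := exists_partrec_leftInverse (e := selfDelim) primrec_selfDelim.to_comp
    fun a b h => (selfDelim_append_inj (s := []) (t := []) (by rw [h])).1
  have hV : IsPrefixMachine fun p _ => d p := by
    refine ⟨hd.comp Computable.fst, fun _ p q hp hq hpq => ?_⟩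
    obtain ⟨a, ha⟩ := Part.dom_iff_mem.1 hp
    obtain ⟨b, hb⟩ := Part.dom_iff_mem.1 hq
    rw [hspec] at ha hb
    subst ha hb
    obtain ⟨r, hr⟩ := hpq
    rw [← List.append_nil (selfDelim b)] at hr
    rw [(selfDelim_append_inj hr).1]
  obtain ⟨c, hc⟩ := hU.universal _ hV
  obtain ⟨q, hq, -⟩ := hc (selfDelim x) y x ((hspec _ _).2 rfl)
  exact Nat.sInf_mem (s := {l : ℕ | ∃ p : Word, x ∈ U p y ∧ p.length = l}) ⟨_, q, hq, rfl⟩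

/-- A partial recursive function does not increase the complexity. -/
theorem exists_K_map_le (hU : IsUniversalPrefixMachine U) {f : Word →. Word} (hf : Partrec f) :
    ∃ c : ℕ, ∀ x z y, z ∈ f x → K U z y ≤ K U x y + c := by
  have hV : IsPrefixMachine fun p y => (U p y).bind f := by
    refine ⟨Partrec.bind hU.isPrefixMachine.partrec (hf.comp Computable.snd).to₂, ?_⟩
    exact fun y p q hp hq => hU.isPrefixMachine.prefixFree y p q hp.fst hq.fst
  obtain ⟨c, hc⟩ := exists_K_le_of_machine hU hV
  refine ⟨c, fun x z y hz => ?_⟩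
  obtain ⟨p, hp, hlen⟩ := exists_program hU x y
  rw [← hlen]
  exact hc p y z (Part.mem_bind hp hz)

theorem exists_partrec_untuple :
    ∃ d : Word →. List Word, Partrec d ∧ ∀ l s, l ∈ d s ↔ tuple l = s :=
  exists_partrec_leftInverse computable_tuple tuple_injective

theorem exists_K_map_tuple_le (hU : IsUniversalPrefixMachine U) {g : List Word → Word}
    (hg : Computable g) : ∃ c : ℕ, ∀ l y, K U (g l) y ≤ K U (tuple l) y + c := by
  obtain ⟨d, hd, hspec⟩ := exists_partrec_untuple
  obtain ⟨c, hc⟩ := exists_K_map_le hU (hd.map (hg.comp Computable.snd).to₂)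
  exact ⟨c, fun l y => hc _ _ y (Part.mem_map _ ((hspec _ _).2 rfl))⟩

/-- Concatenation of programs: a program `p` given `y`, followed by a program that is given a
word computed from `p` and `y`. -/
theorem exists_K_pair_le (hU : IsUniversalPrefixMachine U) {h : Word → Word → Word}
    (hh : Computable₂ h) :
    ∃ c : ℕ, ∀ y p q a b, a ∈ U p y → b ∈ U q (h p y) →
      K U (tuple [a, b]) y ≤ p.length + q.length + c := by
  obtain ⟨u, hu, humono, huspec⟩ := exists_stages (f := fun q : Word × Word => U q.1 q.2)
    hU.isPrefixMachine.partrec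
  let R : Word × Word → ℕ → Option Word := fun py n =>
    (decode (α := ℕ × ℕ) n).bind fun w => (u (py.1.take w.1, py.2) w.2).bind fun a =>
      (u (py.1.drop w.1, h (py.1.take w.1) py.2) w.2).map fun b => tuple [a, b]
  have hR : Computable₂ R := by
    refine Computable.option_bind (Computable.decode.comp Computable.snd) ?_
    have hy : Computable fun q : ((Word × Word) × ℕ) × ℕ × ℕ => q.1.1.2 :=
      Computable.snd.comp (Computable.fst.comp Computable.fst)
    have hi : Computable fun q : ((Word × Word) × ℕ) × ℕ × ℕ => q.2.1 :=
      Computable.fst.comp Computable.snd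
    have hp : Computable fun q : ((Word × Word) × ℕ) × ℕ × ℕ => q.1.1.1 :=
      Computable.fst.comp (Computable.fst.comp Computable.fst)
    have hs : Computable fun q : ((Word × Word) × ℕ) × ℕ × ℕ => q.2.2 :=
      Computable.snd.comp Computable.snd
    have htake := Primrec.list_take.to_comp.comp hi hp
    have hdrop := Primrec.list_drop.to_comp.comp hi hp
    refine Computable.option_bind (hu.comp (htake.pair hy) hs) ?_
    refine Computable.option_map ((hu.comp (hdrop.pair (hh.comp htake hy)) hs).comp
      Computable.fst) ?_
    exact computable_tuple.comp (Computable.list_cons.comp (Computable.snd.comp Computable.fst)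
      (Computable.list_cons.comp Computable.snd (Computable.const [])))
  have hspec : ∀ p y n x, R (p, y) n = some x → ∃ p₁ p₂ a b, p = p₁ ++ p₂ ∧ a ∈ U p₁ y ∧
      b ∈ U p₂ (h p₁ y) ∧ x = tuple [a, b] := by
    intro p y n x hx
    obtain ⟨⟨i, s⟩, -, hx⟩ := Option.bind_eq_some_iff.1 hx
    obtain ⟨a, ha, hx⟩ := Option.bind_eq_some_iff.1 hx
    obtain ⟨b, hb, hx⟩ := Option.map_eq_some_iff.1 hx
    exact ⟨p.take i, p.drop i, a, b, (List.take_append_drop i p).symm,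
      (huspec _ _).2 ⟨s, ha⟩, (huspec _ _).2 ⟨s, hb⟩, hx.symm⟩
  obtain ⟨c, hc⟩ := exists_K_le_of_stages hU hR (by
    intro y p q n m x x' hx hx' hpq
    obtain ⟨p₁, p₂, a, b, rfl, ha, hb, rfl⟩ := hspec p y n x hx
    obtain ⟨q₁, q₂, a', b', rfl, ha', hb', rfl⟩ := hspec q y m x' hx'
    have hpf := hU.isPrefixMachine.prefixFree
    have h₁ : p₁ = q₁ := by
      rcases List.prefix_or_prefix_of_prefix ((List.prefix_append p₁ p₂).trans hpq)
        (List.prefix_append q₁ q₂) with h' | h'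
      · exact hpf y _ _ (Part.dom_iff_mem.2 ⟨a, ha⟩) (Part.dom_iff_mem.2 ⟨a', ha'⟩) h'
      · exact (hpf y _ _ (Part.dom_iff_mem.2 ⟨a', ha'⟩) (Part.dom_iff_mem.2 ⟨a, ha⟩) h').symm
    subst h₁
    have h₂ : p₂ = q₂ := hpf (h p₁ y) _ _ (Part.dom_iff_mem.2 ⟨b, hb⟩)
      (Part.dom_iff_mem.2 ⟨b', hb'⟩) ((List.prefix_append_right_inj p₁).1 hpq)
    subst h₂
    rw [Part.mem_unique ha ha', Part.mem_unique hb hb']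
    exact ⟨rfl, rfl⟩)
  refine ⟨c, fun y p q a b ha hb => ?_⟩
  obtain ⟨s, hs⟩ := (huspec (p, y) a).1 ha
  obtain ⟨t, ht⟩ := (huspec (q, h p y) b).1 hb
  have := hc (p ++ q) y (encode (p.length, max s t)) (tuple [a, b]) (by
    simp [R, humono _ _ s (max s t) (le_max_left _ _) hs,
      humono _ _ t (max s t) (le_max_right _ _) ht])
  rwa [List.length_append] at this

theorem exists_K_pair_le_add (hU : IsUniversalPrefixMachine U) :
    ∃ c : ℕ, ∀ a b y, K U (tuple [a, b]) y ≤ K U a y + K U b y + c := by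
  obtain ⟨c, hc⟩ := exists_K_pair_le hU (h := fun _ y => y) Computable.snd.to₂
  refine ⟨c, fun a b y => ?_⟩
  obtain ⟨p, hp, hpl⟩ := exists_program hU a y
  obtain ⟨q, hq, hql⟩ := exists_program hU b y
  rw [← hpl, ← hql]
  exact hc y p q a b hp hq

/-- The easy half of the chain rule. -/
theorem exists_K_pair_le_add_K_star (hU : IsUniversalPrefixMachine U) {star : Word → Word}
    (hstar : IsShortestProgramMap U star) :
    ∃ c : ℕ, ∀ a b, K U (tuple [b, a]) [] ≤ K U b [] + K U a (star b) + c := by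
  obtain ⟨c, hc⟩ := exists_K_pair_le hU (h := fun p _ => p) Computable.fst.to₂
  refine ⟨c, fun a b => ?_⟩
  obtain ⟨q, hq, hql⟩ := exists_program hU a (star b)
  rw [← length_star hstar b, ← hql]
  exact hc [] (star b) q b a (hstar b).1 hq

/-- Extending a description `z` by a word `a` costs at most the complexity of `a` given a shortest
program of any word computable from `z`. This is strong subadditivity: given a shortest program of
`b`, describe `z` and `a` separately, and use the symmetry of information for `z`. -/
theorem exists_K_extend_le (hU : IsUniversalPrefixMachine U) {star : Word → Word}
    (hstar : IsShortestProgramMap U star) {f : Word →. Word} (hf : Partrec f) :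
    ∃ c : ℕ, ∀ z a b, b ∈ f z → K U (tuple [z, a]) [] ≤ K U z [] + K U a (star b) + c := by
  obtain ⟨c₁, h₁⟩ := exists_K_pair_le_add_K_star hU hstar
  obtain ⟨c₂, h₂⟩ := exists_K_pair_le_add hU
  obtain ⟨c₃, h₃⟩ := exists_K_add_K_star_le hU hstar hf
  obtain ⟨c₄, h₄⟩ := exists_K_map_tuple_le hU (g := fun l => l.getD 1 [])
    ((Primrec.list_getD []).to_comp.comp Computable.id (Computable.const 1))
  refine ⟨c₁ + c₂ + c₃ + c₄, fun z a b hb => ?_⟩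
  have e₁ := h₁ (tuple [z, a]) b
  have e₂ := h₂ z a (star b)
  have e₃ := h₃ z b hb
  have e₄ := h₄ [b, tuple [z, a]] []
  simp only [List.getD_cons_succ, List.getD_cons_zero] at e₄
  omega

end Elementary

/-! ### Strings at the nodes of a directed acyclic graph -/

section Graphs

variable {U : Machine}

theorem exists_computable_rearrange {V : Type} (L L' : List V) (h : L' ⊆ L) :
    ∃ g : List Word → List Word, Computable g ∧ ∀ w : V → Word, g (L.map w) = L'.map w := by
  classical
  induction L' with
  | nil => exact ⟨fun _ => [], Computable.const [], fun w => rfl⟩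
  | cons v L' ih =>
    obtain ⟨g, hg, hgw⟩ := ih fun x hx => h (List.mem_cons_of_mem _ hx)
    refine ⟨fun l => l.getD (L.idxOf v) [] :: g l, ?_, fun w => ?_⟩
    · exact Computable.list_cons.comp
        ((Primrec.list_getD []).to_comp.comp Computable.id (Computable.const _)) hg
    · have hv : L.idxOf v < L.length := List.idxOf_lt_length_of_mem (h List.mem_cons_self)
      simp [hgw, List.getD_eq_getElem?_getD, List.getElem?_eq_getElem hv]

theorem exists_K_rearrange_le (hU : IsUniversalPrefixMachine U) {V : Type} (L L' : List V)
    (h : L' ⊆ L) : ∃ c : ℕ, ∀ (w : V → Word) y,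
      K U (tuple (L'.map w)) y ≤ K U (tuple (L.map w)) y + c := by
  obtain ⟨g, hg, hgw⟩ := exists_computable_rearrange L L' h
  obtain ⟨c, hc⟩ := exists_K_map_tuple_le hU (computable_tuple.comp hg)
  exact ⟨c, fun w y => by simpa [hgw] using hc (L.map w) y⟩

theorem mem_parents {V : Type} [Fintype V] [LinearOrder V] {G : Digraph V} {u v : V} :
    u ∈ parents G v ↔ G.Adj u v := by
  simp [parents]

/-- Adding a node to a list that contains its parents. -/
theorem exists_K_cons_le (hU : IsUniversalPrefixMachine U) {star : Word → Word}
    (hstar : IsShortestProgramMap U star) {V : Type} [Fintype V] [LinearOrder V] (G : Digraph V)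
    (L : List V) (v : V) (h : ∀ u, G.Adj u v → u ∈ L) :
    ∃ c : ℕ, ∀ w : V → Word, K U (tuple ((v :: L).map w)) [] ≤
      K U (tuple (L.map w)) [] + K U (w v) (star (tuple ((parents G v).map w))) + c := by
  obtain ⟨d, hd, hdspec⟩ := exists_partrec_untuple
  obtain ⟨g, hg, hgw⟩ := exists_computable_rearrange L (parents G v)
    fun u hu => h u (mem_parents.1 hu)
  obtain ⟨c₁, h₁⟩ := exists_K_extend_le hU hstar
    (hd.map ((computable_tuple.comp hg).comp Computable.snd).to₂)
  -- from the pair of the tuple of `L` and the new entry to the tuple of `v :: L`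
  have hf : Partrec fun s => (d s).bind fun m =>
      (d (m.getD 0 [])).map fun l => tuple (m.getD 1 [] :: l) := by
    have hget : ∀ i, Computable fun m : List Word => m.getD i [] := fun i =>
      (Primrec.list_getD []).to_comp.comp Computable.id (Computable.const i)
    refine hd.bind ?_
    refine Partrec.map (hd.comp ((hget 0).comp Computable.snd)) ?_
    exact computable_tuple.comp (Computable.list_cons.comp
      ((hget 1).comp (Computable.snd.comp Computable.fst)) Computable.snd)
  obtain ⟨c₂, h₂⟩ := exists_K_map_le hU hf
  refine ⟨c₁ + c₂, fun w => ?_⟩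
  have e₁ := h₁ (tuple (L.map w)) (w v) (tuple ((parents G v).map w)) (by
    have := Part.mem_map (fun l => tuple (g l)) ((hdspec (L.map w) _).2 rfl)
    rwa [hgw] at this)
  have e₂ := h₂ (tuple [tuple (L.map w), w v]) (tuple ((v :: L).map w)) [] (by
    refine Part.mem_bind ((hdspec _ _).2 rfl) ?_
    exact Part.mem_map _ ((hdspec (L.map w) _).2 rfl))
  omega

/-- A nonempty set of nodes of a finite acyclic graph contains a node without children in it. -/
theorem exists_sink {V : Type} [Finite V] {G : Digraph V} (hG : Acyclic G) {s : Finset V}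
    (hs : s.Nonempty) : ∃ v ∈ s, ∀ u ∈ s, ¬ G.Adj v u := by
  have : Std.Irrefl (Relation.TransGen G.Adj) := ⟨hG⟩
  have hwf : WellFounded (Function.swap (Relation.TransGen G.Adj)) := by
    have : IsTrans V (Function.swap (Relation.TransGen G.Adj)) := ⟨fun _ _ _ h h' => h'.trans h⟩
    have : Std.Irrefl (Function.swap (Relation.TransGen G.Adj)) := ⟨hG⟩
    exact Finite.wellFounded_of_trans_of_irrefl _
  obtain ⟨v, hv, hmin⟩ := hwf.has_min (s : Set V) hs
  exact ⟨v, hv, fun u hu h => hmin u hu (Relation.TransGen.single h)⟩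

/-- In a directed acyclic graph, the strings of an ancestor-closed set `s` are described by those of
a smaller ancestor-closed set `s₀` together with, at each further node, a description given a
shortest program of the parents. -/
theorem exists_K_ancestral_le (hU : IsUniversalPrefixMachine U) {star : Word → Word}
    (hstar : IsShortestProgramMap U star) {V : Type} [Fintype V] [LinearOrder V] {G : Digraph V}
    (hG : Acyclic G) {s₀ : Finset V} (hs₀ : ∀ v ∈ s₀, ∀ u, G.Adj u v → u ∈ s₀) (s : Finset V)
    (hs : ∀ v ∈ s, ∀ u, G.Adj u v → u ∈ s) (hsub : s₀ ⊆ s) :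
    ∃ c : ℕ, ∀ w : V → Word, K U (tuple ((s.sort (· ≤ ·)).map w)) [] ≤
      K U (tuple ((s₀.sort (· ≤ ·)).map w)) [] +
        ∑ v ∈ s \ s₀, K U (w v) (star (tuple ((parents G v).map w))) + c := by
  induction s using Finset.strongInduction with
  | H s ih =>
    by_cases hne : (s \ s₀).Nonempty
    · obtain ⟨v, hv, hsink⟩ := exists_sink hG hne
      obtain ⟨hvs, hvs₀⟩ := Finset.mem_sdiff.1 hv
      have hclosed : ∀ u ∈ s.erase v, ∀ t, G.Adj t u → t ∈ s.erase v := by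
        intro u hu t htu
        obtain ⟨huv, hus⟩ := Finset.mem_erase.1 hu
        refine Finset.mem_erase.2 ⟨?_, hs u hus t htu⟩
        rintro rfl
        by_cases hu₀ : u ∈ s₀
        · exact hvs₀ (hs₀ u hu₀ _ htu)
        · exact hsink u (Finset.mem_sdiff.2 ⟨hus, hu₀⟩) htu
      obtain ⟨c₁, h₁⟩ := ih (s.erase v) (Finset.erase_ssubset hvs) hclosed
        (Finset.subset_erase.2 ⟨hsub, hvs₀⟩)
      obtain ⟨c₂, h₂⟩ := exists_K_cons_le hU hstar G ((s.erase v).sort (· ≤ ·)) v (by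
        intro u hu
        rw [Finset.mem_sort, Finset.mem_erase]
        refine ⟨?_, hs v hvs u hu⟩
        rintro rfl
        exact hG _ (Relation.TransGen.single hu))
      obtain ⟨c₃, h₃⟩ := exists_K_rearrange_le hU (v :: (s.erase v).sort (· ≤ ·))
        (s.sort (· ≤ ·)) (by
          intro u hu
          rw [Finset.mem_sort] at hu
          by_cases huv : u = v
          · simp [huv]
          · simp [huv, hu])
      refine ⟨c₁ + c₂ + c₃, fun w => ?_⟩
      have e₁ := h₁ w
      have e₂ := h₂ w
      have e₃ := h₃ w []
      rw [← Finset.add_sum_erase _ _ hv, ← Finset.erase_sdiff_comm]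
      omega
    · have : s = s₀ := Finset.Subset.antisymm
        (Finset.sdiff_eq_empty_iff_subset.1 (Finset.not_nonempty_iff_eq_empty.1 hne)) hsub
      exact ⟨0, fun w => by rw [this]; omega⟩

end Graphs

/-! ### Decomposition of the complexity in the augmented graph -/

section Augmented

variable {n : ℕ}

theorem sum_lex_eq {M : Type*} [AddCommMonoid M] (f : Fin n ⊕ₗ Fin n → M) :
    ∑ v, f v = ∑ j : Fin n, f (Sum.inlₗ j) + ∑ j : Fin n, f (Sum.inrₗ j) :=
  (Equiv.sum_comp toLex f).symm.trans (Fintype.sum_sum_type _)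

/-- The nodes of the mechanisms in the augmented graph. -/
def mechNodes (n : ℕ) : Finset (Fin n ⊕ₗ Fin n) :=
  Finset.univ.map ⟨Sum.inrₗ, fun _ _ h => Sum.inr_injective (toLex.injective h)⟩

theorem mem_mechNodes {v : Fin n ⊕ₗ Fin n} : v ∈ mechNodes n ↔ ∃ j, Sum.inrₗ j = v := by
  simp only [mechNodes, Finset.mem_map, Finset.mem_univ, true_and]
  exact Iff.rfl

theorem sum_mechNodes (f : Fin n ⊕ₗ Fin n → ℕ) :
    ∑ v ∈ mechNodes n, f v = ∑ j : Fin n, f (Sum.inrₗ j) := by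
  rw [mechNodes, Finset.sum_map]
  rfl

theorem sum_univ_sdiff_mechNodes {_ : DecidableEq (Fin n ⊕ₗ Fin n)} (f : Fin n ⊕ₗ Fin n → ℕ) :
    ∑ v ∈ Finset.univ \ mechNodes n, f v = ∑ j : Fin n, f (Sum.inlₗ j) := by
  have h := Finset.sum_sdiff (f := f) (Finset.subset_univ (mechNodes n))
  rw [sum_mechNodes, sum_lex_eq] at h
  omega

/-- In an acyclic graph in which the mechanisms are roots, the algorithmic Markov condition
decomposes the complexity of the observations given a shortest program of all mechanisms. The upper
bound does not need the condition. For the lower bound, the condition makes the complexity of all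
strings at least `∑ K(P_j)` plus the claimed sum, up to a constant, while the mechanisms account
for no more than `∑ K(P_j)` of it. -/
theorem exists_abs_K_sub_sum_le {U : Machine} (hU : IsUniversalPrefixMachine U)
    {star : Word → Word} (hstar : IsShortestProgramMap U star) (C : ℝ)
    {H : Digraph (Fin n ⊕ₗ Fin n)} (hH : Acyclic H) (hroot : ∀ u j, ¬ H.Adj u (Sum.inrₗ j)) :
    ∃ C' : ℝ, ∀ w : Fin n ⊕ₗ Fin n → Word, AlgMarkov U star H w C →
      |(K U (tuple (List.ofFn fun j => w (Sum.inlₗ j)))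
          (star (tuple (List.ofFn fun j => w (Sum.inrₗ j)))) : ℝ) -
        ∑ j : Fin n, (K U (w (Sum.inlₗ j))
          (star (tuple ((parents H (Sum.inlₗ j)).map w))) : ℝ)| ≤ C' := by
  let all := (Finset.univ : Finset (Fin n ⊕ₗ Fin n)).sort (· ≤ ·)
  let obs : List (Fin n ⊕ₗ Fin n) := List.ofFn fun j : Fin n => Sum.inlₗ j
  let mech : List (Fin n ⊕ₗ Fin n) := List.ofFn fun j : Fin n => Sum.inrₗ j
  have hall : ∀ v, v ∈ all := fun v => by simp [all]
  have hmech : ∀ v, v ∈ mech ↔ v ∈ mechNodes n := fun v => by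
    rw [mem_mechNodes, List.mem_ofFn]
  obtain ⟨d, hd, hdspec⟩ := exists_partrec_untuple
  obtain ⟨c₁, h₁⟩ := exists_K_ancestral_le hU hstar hH (s₀ := mechNodes n) (by
    intro v hv u huv
    obtain ⟨j, rfl⟩ := mem_mechNodes.1 hv
    exact absurd huv (hroot u j)) Finset.univ (fun _ _ _ _ => Finset.mem_univ _)
    (Finset.subset_univ _)
  obtain ⟨c₂, h₂⟩ := exists_K_ancestral_le hU hstar hH (s₀ := ∅) (by simp) (mechNodes n) (by
    intro v hv u huv
    obtain ⟨j, rfl⟩ := mem_mechNodes.1 hv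
    exact absurd huv (hroot u j)) (Finset.empty_subset _)
  obtain ⟨c₃, h₃⟩ := exists_K_rearrange_le hU mech ((mechNodes n).sort (· ≤ ·))
    fun v hv => (hmech v).2 ((Finset.mem_sort _).1 hv)
  obtain ⟨c₄, h₄⟩ := exists_K_rearrange_le hU ((mechNodes n).sort (· ≤ ·)) mech
    fun v hv => (Finset.mem_sort _).2 ((hmech v).1 hv)
  obtain ⟨g, hg, hgw⟩ := exists_computable_rearrange all mech fun v _ => hall v
  obtain ⟨c₅, h₅⟩ := exists_K_add_K_star_le hU hstar
    (hd.map ((computable_tuple.comp hg).comp Computable.snd).to₂)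
  obtain ⟨c₆, h₆⟩ := exists_K_rearrange_le hU all obs fun v _ => hall v
  obtain ⟨c₇, h₇⟩ := exists_K_pair_le_add_K_star hU hstar
  obtain ⟨e, he, hew⟩ := exists_computable_rearrange (mech ++ obs) all (by
    intro v _
    rw [List.mem_append, List.mem_ofFn, List.mem_ofFn]
    rcases v with j | j
    exacts [Or.inr ⟨j, rfl⟩, Or.inl ⟨j, rfl⟩])
  -- from the pair of the tuples of the mechanisms and of the observations to the tuple of all nodes
  have hf : Partrec fun s => (d s).bind fun m => (d (m.getD 0 [])).bind fun l =>
      (d (m.getD 1 [])).map fun l' => tuple (e (l ++ l')) := by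
    have hget : ∀ i, Computable fun m : List Word => m.getD i [] := fun i =>
      (Primrec.list_getD []).to_comp.comp Computable.id (Computable.const i)
    refine hd.bind (Partrec.bind (hd.comp ((hget 0).comp Computable.snd)) ?_)
    refine Partrec.map (hd.comp ((hget 1).comp (Computable.snd.comp Computable.fst))) ?_
    exact computable_tuple.comp (he.comp (Computable.list_append.comp
      (Computable.snd.comp Computable.fst) Computable.snd))
  obtain ⟨c₈, h₈⟩ := exists_K_map_le hU hf
  refine ⟨|C| + c₁ + c₂ + c₃ + c₄ + c₅ + c₆ + c₇ + c₈ + K U (tuple []) [], fun w hw => ?_⟩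
  have hobs : List.ofFn (fun j => w (Sum.inlₗ j)) = obs.map w := by
    rw [List.map_ofFn]; rfl
  have hmech' : List.ofFn (fun j => w (Sum.inrₗ j)) = mech.map w := by
    rw [List.map_ofFn]; rfl
  rw [hobs, hmech']
  have e₁ := h₁ w
  have e₂ := h₂ w
  have e₃ := h₃ w []
  have e₄ := h₄ w []
  have e₅ := h₅ (tuple (all.map w)) (tuple (mech.map w)) (by
    have := Part.mem_map (fun l => tuple (g l)) ((hdspec (all.map w) _).2 rfl)
    rwa [hgw] at this)
  have e₆ := h₆ w (star (tuple (mech.map w)))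
  have e₇ := h₇ (tuple (obs.map w)) (tuple (mech.map w))
  have e₈ := h₈ (tuple [tuple (mech.map w), tuple (obs.map w)]) (tuple (all.map w)) [] (by
    refine Part.mem_bind ((hdspec _ _).2 rfl) (Part.mem_bind ((hdspec (mech.map w) _).2 rfl) ?_)
    have := Part.mem_map (fun l => tuple (e (mech.map w ++ l))) ((hdspec (obs.map w) _).2 rfl)
    rwa [← List.map_append, hew] at this)
  rw [sum_univ_sdiff_mechNodes] at e₁
  rw [Finset.sdiff_empty, sum_mechNodes, Finset.sort_empty, List.map_nil] at e₂
  unfold AlgMarkov at hw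
  rw [sum_lex_eq, abs_le] at hw
  have hC := le_abs_self C
  rify at e₁ e₂ e₃ e₄ e₅ e₆ e₇ e₈
  rw [abs_le]
  constructor <;> linarith [hw.1, hw.2]

end Augmented

/-! ### Causal networks -/

namespace CausalNetwork

variable {n : ℕ} (N : CausalNetwork n)

theorem not_adj_augmented_inr (u : Fin n ⊕ₗ Fin n) (j : Fin n) :
    ¬ N.augmented.Adj u (Sum.inrₗ j) := by
  rcases u with i | i <;> exact id

/-- A directed path of the augmented graph between observations is a path of `G`, since mechanisms
have no parents. -/
theorem acyclic_augmented : Acyclic N.augmented := by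
  have hlift : ∀ u v, Relation.TransGen N.augmented.Adj u v → ∀ i j, u = Sum.inlₗ i →
      v = Sum.inlₗ j → Relation.TransGen N.G.Adj i j := by
    intro u v h
    induction h with
    | single h =>
      rintro i j rfl rfl
      exact Relation.TransGen.single h
    | @tail b c hp h ih =>
      rintro i j rfl rfl
      rcases b with k | k
      · exact (ih i k rfl rfl).tail h
      · rcases hp with hp | ⟨-, hp⟩ <;> exact (N.not_adj_augmented_inr _ k hp).elim
  rintro (j | j) h
  · exact N.acyclic j (hlift _ _ h j j rfl rfl)
  · rcases h with h | ⟨-, h⟩ <;> exact N.not_adj_augmented_inr _ j h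

theorem parents_augmented (j : Fin n) : parents N.augmented (Sum.inlₗ j) =
    (parents N.G j).map Sum.inlₗ ++ [Sum.inrₗ j] := by
  classical
  refine List.Perm.eq_of_pairwise' (r := (· ≤ ·)) ?_ ?_ ?_
  · exact Finset.pairwise_sort _ _
  · rw [List.pairwise_append, List.pairwise_map]
    refine ⟨(Finset.pairwise_sort (Finset.univ.filter fun u => N.G.Adj u j) (· ≤ ·)).imp
      fun h => Sum.Lex.inl_le_inl_iff.2 h, by simp, ?_⟩
    intro a ha b hb
    obtain ⟨i, -, rfl⟩ := List.mem_map.1 ha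
    rw [List.mem_singleton.1 hb]
    exact Sum.Lex.inl_le_inr _ _
  · have hinl : Function.Injective (Sum.inlₗ : Fin n → Fin n ⊕ₗ Fin n) := fun _ _ h =>
      Sum.inl_injective (toLex.injective h)
    refine (List.perm_ext_iff_of_nodup (Finset.sort_nodup _ _) ?_).2 fun v => ?_
    · rw [List.nodup_append]
      refine ⟨(Finset.sort_nodup _ _).map hinl, List.nodup_singleton _, ?_⟩
      rintro a ha b hb rfl
      obtain ⟨i, -, hi⟩ := List.mem_map.1 ha
      rw [List.mem_singleton] at hb
      exact Sum.inl_ne_inr (toLex.injective (hi.trans hb))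
    · refine (mem_parents (G := N.augmented)).trans ?_
      rw [List.mem_append, List.mem_map, List.mem_singleton]
      rcases v with i | i
      · constructor
        · exact fun h => Or.inl ⟨i, mem_parents.2 h, rfl⟩
        · rintro (⟨k, hk, h⟩ | h)
          · obtain rfl := hinl h
            exact (mem_parents (G := N.G)).1 hk
          · exact (Sum.inl_ne_inr (toLex.injective h)).elim
      · constructor
        · exact fun h => Or.inr (congrArg Sum.inrₗ (show i = j from h))
        · rintro (⟨k, -, h⟩ | h)
          · exact (Sum.inl_ne_inr (toLex.injective h)).elim
          · exact Sum.inr_injective (toLex.injective h)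

theorem map_parents_augmented (x : Fin n → Word) (j : Fin n) :
    (parents N.augmented (Sum.inlₗ j)).map (N.augmentedWord x) = N.pa x j ++ [N.mech j] := by
  rw [parents_augmented, List.map_append, List.map_map]
  rfl

end CausalNetwork

/-! ### Randomness deficiencies -/

theorem sum_ne_bot {ι : Type*} (s : Finset ι) (f : ι → EReal) (h : ∀ i ∈ s, f i ≠ ⊥) :
    ∑ i ∈ s, f i ≠ ⊥ := by
  classical
  induction s using Finset.induction_on with
  | empty => simp
  | insert i s hi ih =>
    rw [Finset.sum_insert hi]
    simp only [ne_eq, EReal.add_eq_bot_iff, not_or]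
    exact ⟨h i (by simp), ih fun j hj => h j (Finset.mem_insert_of_mem hj)⟩

theorem negLog_sub_coe_ne_bot (p a : ℝ) : negLog p - (a : EReal) ≠ ⊥ := by
  unfold negLog
  split_ifs
  · simp
  · rw [← EReal.coe_sub]; exact EReal.coe_ne_bot _

theorem negLog_zero_sub_coe (a : ℝ) : negLog 0 - (a : EReal) = ⊤ := by
  simp [negLog]

theorem coe_sum_ereal {ι : Type*} (s : Finset ι) (f : ι → ℝ) :
    ((∑ i ∈ s, f i : ℝ) : EReal) = ∑ i ∈ s, (f i : EReal) := by
  classical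
  induction s using Finset.induction_on with
  | empty => simp
  | insert i s hi ih => rw [Finset.sum_insert hi, Finset.sum_insert hi, EReal.coe_add, ih]

/-- `-log` turns the product of probabilities into a sum, so deficiencies relative to the product
and to the factors differ as much as the subtracted complexities do. -/
theorem negLog_prod_sub_le {n : ℕ} (p b : Fin n → ℝ) (a c : ℝ) (h : |a - ∑ j, b j| ≤ c) :
    negLog (∏ j, p j) - (a : EReal) ≤ (∑ j, (negLog (p j) - (b j : EReal))) + (c : EReal) ∧
    (∑ j, (negLog (p j) - (b j : EReal))) ≤ negLog (∏ j, p j) - (a : EReal) + (c : EReal) := by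
  by_cases hp : ∏ j, p j = 0
  · obtain ⟨j, -, hj⟩ := Finset.prod_eq_zero_iff.1 hp
    have htop : ∑ j, (negLog (p j) - (b j : EReal)) = ⊤ := by
      rw [← Finset.add_sum_erase _ _ (Finset.mem_univ j), hj, negLog_zero_sub_coe]
      exact EReal.top_add_of_ne_bot (sum_ne_bot _ _ fun i _ => negLog_sub_coe_ne_bot _ _)
    rw [hp, htop, negLog_zero_sub_coe]
    simp
  · have hp' : ∀ j, p j ≠ 0 := fun j => Finset.prod_ne_zero_iff.1 hp j (Finset.mem_univ j)
    have hterm : ∀ j, negLog (p j) - (b j : EReal) = ((-Real.logb 2 (p j) - b j : ℝ) : EReal) :=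
      fun j => by rw [negLog, if_neg (hp' j), EReal.coe_sub]
    simp only [hterm]
    rw [negLog, if_neg hp, ← coe_sum_ereal, ← EReal.coe_sub, ← EReal.coe_add, ← EReal.coe_add,
      EReal.coe_le_coe_iff, EReal.coe_le_coe_iff, Real.logb_prod _ _ fun j _ => hp' j,
      Finset.sum_sub_distrib, Finset.sum_neg_distrib]
    rw [abs_le] at h
    constructor <;> linarith

end AlgCausal

theorem mainTheorem1 (U : AlgCausal.Machine) (hU : AlgCausal.IsUniversalPrefixMachine U)
    (star : AlgCausal.Word → AlgCausal.Word) (hstar : AlgCausal.IsShortestProgramMap U star)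
    (n : ℕ) (C : ℝ) :
    ∃ C' : ℝ, ∀ (N : AlgCausal.CausalNetwork n) (x : Fin n → AlgCausal.Word),
      (∀ j, x j ∈ N.dom j) →
      AlgCausal.AlgMarkov U star N.augmented (N.augmentedWord x) C →
        N.jointDeficiency U star x ≤ (∑ j : Fin n, N.condDeficiency U star x j) + (C' : EReal) ∧
        (∑ j : Fin n, N.condDeficiency U star x j) ≤ N.jointDeficiency U star x + (C' : EReal) := by
  classical
  have hconst : ∀ H : Digraph (Fin n ⊕ₗ Fin n), ∃ C' : ℝ, AlgCausal.Acyclic H →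
      (∀ u j, ¬ H.Adj u (Sum.inrₗ j)) → ∀ w, AlgCausal.AlgMarkov U star H w C → _ ≤ C' := fun H =>
    if h : AlgCausal.Acyclic H ∧ ∀ u j, ¬ H.Adj u (Sum.inrₗ j) then
      (AlgCausal.exists_abs_K_sub_sum_le hU hstar C h.1 h.2).imp fun _ hC' _ _ => hC'
    else ⟨0, fun h₁ h₂ => absurd ⟨h₁, h₂⟩ h⟩
  choose c hc using hconst
  -- there are only finitely many graphs on the nodes of `G^1`
  have : Finite (Digraph (Fin n ⊕ₗ Fin n)) :=
    Finite.of_injective (β := Fin n ⊕ₗ Fin n → Fin n ⊕ₗ Fin n → Prop) Digraph.Adj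
      fun _ _ h => Digraph.ext h
  obtain ⟨C', hC'⟩ := (Set.finite_range c).bddAbove
  refine ⟨C', fun N x _ hx => ?_⟩
  have h := (hc N.augmented N.acyclic_augmented N.not_adj_augmented_inr _ hx).trans (hC' ⟨_, rfl⟩)
  simp only [N.map_parents_augmented] at h
  exact AlgCausal.negLog_prod_sub_le (fun j => N.prob j (N.pa x j) (x j)) _ _ C' h
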